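/- Let $G=(V,E,c)$ be a finite undirected graph with positive edge costs, $n=|V|$, and for disjoint $A,B\subseteq V$ let $c(A,B)$ be the total cost of the edges between $A$ and $B$. A set $S\subseteq V$ is a source community (SC) if there is $s\in S$ such that $c(U,S\setminus U)>c(U,V\setminus S)$ for all nonempty $U\subseteq S\setminus\{s\}$. For vertices $s\neq t$ let $SC(s,t)$ be the side of $s$ of the minimum $s$-$t$-cut that has the fewest vertices on the side of $s$. A clustering is a partition of $V$ into nonempty sets; $\Omega\le\Omega'$ ($\Omega$ is hierarchically nested in $\Omega'$) means that every cluster of $\Omega$ is a subset of a cluster of $\Omega'$. Let $\mathcal T(G)$ be a rooted cut tree of $G$ on the vertex set $V$, with edges directed to the leaves, such that for each edge $(t,s)$ the set of vertices of the subtree rooted in $s$ is $SC(s,t)$, and $|SC(s,t)|\le|SC(t,s)|$. Theorem. Let $S$ be an SC in $G$. (1) Among the clusterings of $G$ that contain $S$ and otherwise consist of SCs there is a unique maximal one with respect to $\le$, denoted $\Omega(S)$. Every clustering that contains $S$ and otherwise consists of SCs is hierarchically nested in $\Omega(S)$, and every SC that is disjoint from $S$ is a subset of a cluster of $\Omega(S)$.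 (2) For every tree $\mathcal T(G)$ as above, $\Omega(S)$ is obtained by deleting subtrees from it: put $S_0=S$ and $\mathcal T_0=\mathcal T(G)$. Delete from $\mathcal T_i$ the subtree induced by $S_i$. If $S_i$ contains the root of $\mathcal T(G)$, stop; otherwise let $\mathcal T_{i+1}$ be the remaining component that contains the root of $\mathcal T(G)$ and let $S_{i+1}=SC(p_i,r_i)$, where $r_i$ is the root of the subtree induced by $S_i$ and $p_i$ is the parent of $r_i$. This construction is well defined and terminates, and the clusters of $\Omega(S)$ are exactly the sets $S_i$ and the vertex sets of the remaining components other than the $\mathcal T_{i+1}$. (3) $\Omega(S)$ can be computed in $O(n)$ time after the preprocessing: there are one program for a unit-cost random access machine and one constant $K$ such that, for all $G$, $S$ and $\mathcal T(G)$ as above, the program halts after at most $K\cdot n$ steps with a labelling of the vertices in which two vertices have equal labels if and only if they are in the same cluster of $\Omega(S)$. Its input is (for an arbitrary numbering of the vertices) $n$, the parent array of $\mathcal T(G)$, for each edge $(t,s)$ of $\mathcal T(G)$ the opposite SC $SC(t,s)$ as a row of a $0/1$ matrix, and $S$ as a $0/1$ array. -/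

import Mathlib

/-- An undirected graph `(V, E, c)` with a positive edge cost function `c`. -/
structure WGraph (V : Type*) where
  graph : SimpleGraph V
  edgeCost : Sym2 V → ℝ
  edgeCost_pos : ∀ e ∈ graph.edgeSet, 0 < edgeCost e

namespace WGraph

variable {V : Type*} [Fintype V] [DecidableEq V]

open Classical in
/-- `c(A, B)`: the sum of the costs of all edges with one end in `A` and one end in `B`
(used for disjoint `A`, `B`). -/
noncomputable def cost (G : WGraph V) (A B : Finset V) : ℝ :=
  ∑ a ∈ A, ∑ b ∈ B, if G.graph.Adj a b then G.edgeCost s(a, b) else 0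

/-- `S` is a source community with source `s`: every nonempty subset of `S` that avoids `s` is
strictly more strongly connected to the rest of `S` than to the outside of `S`. -/
def IsSCOf (G : WGraph V) (s : V) (S : Finset V) : Prop :=
  s ∈ S ∧ ∀ U : Finset V, U ⊆ S → U.Nonempty → s ∉ U → G.cost U Sᶜ < G.cost U (S \ U)

/-- `S` is a source community. -/
def IsSC (G : WGraph V) (S : Finset V) : Prop := ∃ s, G.IsSCOf s S

/-- `(X, V \ X)` is a cut with `s ∈ X` that separates `s` from `T`. -/
def Separates (s : V) (T X : Finset V) : Prop := s ∈ X ∧ Disjoint X T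

/-- `(X, V \ X)` is a minimum `s`-`T`-cut, with `s ∈ X`. -/
def IsMinCut (G : WGraph V) (s : V) (T X : Finset V) : Prop :=
  Separates s T X ∧ ∀ Y : Finset V, Separates s T Y → G.cost X Xᶜ ≤ G.cost Y Yᶜ

/-- `S = SC(s, T)`: the cut `(S, V \ S)` is the minimum `s`-`T`-cut that has as few
vertices as possible on the side of `s`. -/
def IsCommunity (G : WGraph V) (s : V) (T S : Finset V) : Prop :=
  G.IsMinCut s T S ∧ ∀ X : Finset V, G.IsMinCut s T X → S.card ≤ X.card

/-- A clustering (a partition of `V`) that contains `S` and otherwise consists of source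
communities. Hierarchical nesting of clusterings is the order of `Finpartition`. -/
def IsSCClustering (G : WGraph V) (S : Finset V)
    (Ω : Finpartition (Finset.univ : Finset V)) : Prop :=
  S ∈ Ω.parts ∧ ∀ C ∈ Ω.parts, C ≠ S → G.IsSC C

/-- A rooted tree on `V`, with edges directed to the leaves, that is given by its parent function
(the root is its own parent). -/
structure RootedTree (V : Type*) where
  root : V
  parent : V → V
  parent_root : parent root = root
  reaches_root : ∀ v, ∃ k : ℕ, parent^[k] v = root

open Classical in
/-- The vertices of the subtree rooted in `v`, that is, the side of `v` of the cut that the tree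
edge `(parent v, v)` induces. -/
noncomputable def RootedTree.subtree (T : RootedTree V) (v : V) : Finset V :=
  Finset.univ.filter fun w => ∃ k : ℕ, T.parent^[k] w = v

/-- The underlying undirected tree. -/
def RootedTree.toGraph (T : RootedTree V) : SimpleGraph V :=
  SimpleGraph.fromRel fun u v => T.parent u = v

/-- The vertex sets of the connected components of the subgraph of the tree induced by `A`. -/
def RootedTree.components (T : RootedTree V) (A : Finset V) : Set (Finset V) :=
  {C | ∃ K : (T.toGraph.induce (A : Set V)).ConnectedComponent,
    (C : Set V) = Subtype.val '' K.supp}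

/-- `T` is a rooted cut tree in which each edge `(t, s)` represents
`SC(s, t)`, and `|SC(s, t)| ≤ |SC(t, s)|`.
(The weight of an edge is the cost of the cut that it induces.) -/
def IsCommunityCutTree (G : WGraph V) (T : RootedTree V) : Prop :=
  ∀ v, v ≠ T.root →
    G.IsCommunity v {T.parent v} (T.subtree v) ∧
    ∀ X, G.IsCommunity (T.parent v) {v} X → (T.subtree v).card ≤ X.card

/-- The decomposition of a cut tree. `G.Peel T A S 𝒞` says that `𝒞` is obtained from
the subtree `T[A]`, which contains the root of `T`, as follows.
Delete `T[S]`. If the root of `T` is in `S`, then `𝒞` consists of `S` and of the remaining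
components. Otherwise, let `A'` be the component that contains the root of `T`, let
`r` be the root of `T[S]` and `p` its parent: `𝒞` consists of `S`, of the other components, and
of what is obtained in the same way from `A'` and `SC(p, r)`. -/
inductive Peel (G : WGraph V) (T : RootedTree V) :
    Finset V → Finset V → Set (Finset V) → Prop
  | last {A S : Finset V} (hroot : T.root ∈ S) :
      Peel G T A S ({S} ∪ T.components (A \ S))
  | step {A S A' S' : Finset V} {r : V} {𝒞 : Set (Finset V)} (hroot : T.root ∉ S)
      (hr : r ∈ S) (hSr : S ⊆ T.subtree r)
      (hA' : A' ∈ T.components (A \ S)) (hrootA' : T.root ∈ A')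
      (hS' : G.IsCommunity (T.parent r) {r} S') (hrec : Peel G T A' S' 𝒞) :
      Peel G T A S ({S} ∪ (T.components (A \ S) \ {A'}) ∪ 𝒞)

end WGraph

/-! A random access machine with unit costs. It has registers and arrays holding natural numbers,
and reads a number `n`, two arrays and a matrix as its input. As the only arithmetic operations are
the increment and the decrement, `t` steps increase no number by more than `t`. -/
namespace RAM

/-- The read-only input. -/
structure Input where
  n : ℕ
  par : ℕ → ℕ
  mem : ℕ → ℕ
  opp : ℕ → ℕ → ℕ

/-- The contents of the registers and of the arrays. -/
structure State where
  reg : ℕ → ℕ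
  arr : ℕ → ℕ → ℕ

/-- Elementary instructions. `d`, `s`, `i`, `j` are registers, `a` is an array. -/
inductive Instr : Type
  | const (d k : ℕ)
  | move (d s : ℕ)
  | inc (d : ℕ)
  | dec (d : ℕ)
  | load (d a i : ℕ)
  | store (a i s : ℕ)
  | size (d : ℕ)
  | readPar (d i : ℕ)
  | readMem (d i : ℕ)
  | readOpp (d i j : ℕ)

/-- The assignment of `x` to register `d`. -/
def State.setReg (σ : State) (d x : ℕ) : State :=
  { σ with reg := Function.update σ.reg d x }

/-- The assignment of `x` to cell `i` of array `a`. -/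
def State.setArr (σ : State) (a i x : ℕ) : State :=
  { σ with arr := Function.update σ.arr a (Function.update (σ.arr a) i x) }

/-- The effect of an instruction. -/
def Instr.run (I : Input) (σ : State) : Instr → State
  | .const d k => σ.setReg d k
  | .move d s => σ.setReg d (σ.reg s)
  | .inc d => σ.setReg d (σ.reg d + 1)
  | .dec d => σ.setReg d (σ.reg d - 1)
  | .load d a i => σ.setReg d (σ.arr a (σ.reg i))
  | .store a i s => σ.setArr a (σ.reg i) (σ.reg s)
  | .size d => σ.setReg d I.n
  | .readPar d i => σ.setReg d (I.par (σ.reg i))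
  | .readMem d i => σ.setReg d (I.mem (σ.reg i))
  | .readOpp d i j => σ.setReg d (I.opp (σ.reg i) (σ.reg j))

/-- Comparisons of two registers. -/
inductive Test : Type
  | eq (i j : ℕ)
  | lt (i j : ℕ)

/-- The truth of a comparison. -/
def Test.holds (σ : State) : Test → Prop
  | .eq i j => σ.reg i = σ.reg j
  | .lt i j => σ.reg i < σ.reg j

/-- Programs. -/
inductive Prog : Type
  | skip
  | instr (c : Instr)
  | seq (p q : Prog)
  | ifThenElse (b : Test) (p q : Prog)
  | loop (b : Test) (p : Prog)

/-- `Exec I p σ t τ`: on input `I`, program `p` started in state `σ` halts in state `τ` after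
exactly `t` steps, where each instruction and each evaluation of a comparison is one step. -/
inductive Exec (I : Input) : Prog → State → ℕ → State → Prop
  | skip (σ : State) : Exec I .skip σ 0 σ
  | instr (c : Instr) (σ : State) : Exec I (.instr c) σ 1 (c.run I σ)
  | seq {p q : Prog} {σ τ ρ : State} {t u : ℕ} :
      Exec I p σ t τ → Exec I q τ u ρ → Exec I (.seq p q) σ (t + u) ρ
  | ifTrue {b : Test} {p q : Prog} {σ τ : State} {t : ℕ} :
      b.holds σ → Exec I p σ t τ → Exec I (.ifThenElse b p q) σ (1 + t) τ
  | ifFalse {b : Test} {p q : Prog} {σ τ : State} {t : ℕ} :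
      ¬ b.holds σ → Exec I q σ t τ → Exec I (.ifThenElse b p q) σ (1 + t) τ
  | loopTrue {b : Test} {p : Prog} {σ τ ρ : State} {t u : ℕ} :
      b.holds σ → Exec I p σ t τ → Exec I (.loop b p) τ u ρ →
      Exec I (.loop b p) σ (1 + t + u) ρ
  | loopFalse {b : Test} {p : Prog} {σ : State} :
      ¬ b.holds σ → Exec I (.loop b p) σ 1 σ

/-- All registers and all array cells are zero at the start. -/
def State.init : State := ⟨fun _ => 0, fun _ _ => 0⟩

/-- The input encodes, with respect to the numbering `e` of the vertices, the parent array of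
the tree `T`, the characteristic vector of `S`, and the matrix whose row `v`, for each tree
edge `(p, v)`, is the characteristic vector of the opposite source community `SC(p, v)`. -/
def Input.Encodes {V : Type*} [Fintype V] [DecidableEq V] (I : Input)
    (e : V ≃ Fin (Fintype.card V)) (G : WGraph V) (T : WGraph.RootedTree V) (S : Finset V) :
    Prop :=
  I.n = Fintype.card V ∧
  (∀ v, I.par (e v) = e (T.parent v)) ∧
  (∀ v, I.mem (e v) = if v ∈ S then 1 else 0) ∧
  (∀ v, v ≠ T.root → ∃ X, G.IsCommunity (T.parent v) {v} X ∧
    ∀ w, I.opp (e v) (e w) = if w ∈ X then 1 else 0)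

/-- Array `0` holds a labelling of the vertices in which two vertices have equal labels if
and only if they are in the same cluster of `Ω`. -/
def State.Outputs {V : Type*} [Fintype V] [DecidableEq V] (σ : State)
    (e : V ≃ Fin (Fintype.card V)) (Ω : Finpartition (Finset.univ : Finset V)) : Prop :=
  ∀ u v, σ.arr 0 (e u) = σ.arr 0 (e v) ↔ ∃ C ∈ Ω.parts, u ∈ C ∧ v ∈ C

end RAM

/-! Write d(X) for the cost of the cut (X, V \ X). Moving U out of S changes d(S) by c(U, S \ U) -
c(U, V \ S), so S is an SC with source s exactly when it is strictly cheaper than each of its proper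
subsets containing s (`isSCOf_iff`). Submodularity of d then uncrosses SCs: two SCs are disjoint if
neither contains the source of the other (`IsSCOf.disjoint`), and intersecting SCs have an SC as
their union (`IsSC.union`). Hence the maximal SCs disjoint from S are pairwise disjoint. As
singletons are SCs, they partition V together with S, and this partition is Ω(S).

For the tree, every SC induces a connected piece of the cut tree (`exists_isRootOf`). Let X be a
deleted set that is known to be a cluster, r its root and p the parent of r. A newly separated
subtree hanging from X is an SC; a larger SC disjoint from S would contain the edge into X and thus
cross the cluster X, so the subtree is a cluster. An SC that contains p and avoids the subtree of r
lies in SC(p, r) (`subset_opposite`), so the next deleted set is again a cluster. All sets produced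
are clusters and they cover V, so they are all of Ω(S).

For the running time, the path from a vertex of S to the root passes through the deleted sets in
order. Each set is coded by the tree edge it stems from, and codes are copied downwards from the
path. A tree edge joins different clusters exactly when its ends differ in code or in membership of
the coded set (`part_parent_eq_iff`); the top vertex of each cluster then hands its label down.
Copying is linear because every step up the tree is paid for by a cell that gets filled. -/

namespace WGraph

variable {V : Type*}

/-! ### Submodularity of cuts and uncrossing of source communities -/

section Cuts

variable (G : WGraph V)

open Classical in
/-- The cost of the edge between `a` and `b`, and `0` if there is none. -/
noncomputable def weight (a b : V) : ℝ := if G.graph.Adj a b then G.edgeCost s(a, b) else 0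

theorem cost_eq_sum_weight (A B : Finset V) : G.cost A B = ∑ a ∈ A, ∑ b ∈ B, G.weight a b := rfl

theorem weight_nonneg (a b : V) : 0 ≤ G.weight a b := by
  unfold weight
  split_ifs with h
  · exact (G.edgeCost_pos _ h).le
  · exact le_rfl

theorem weight_comm (a b : V) : G.weight a b = G.weight b a := by
  rw [weight, weight, G.graph.adj_comm a b, Sym2.eq_swap]

theorem cost_comm (A B : Finset V) : G.cost A B = G.cost B A := by
  rw [cost_eq_sum_weight, cost_eq_sum_weight, Finset.sum_comm]
  simp only [G.weight_comm]

theorem separates_singleton {s t : V} {X : Finset V} :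
    Separates s {t} X ↔ s ∈ X ∧ t ∉ X := by simp [Separates]

variable [DecidableEq V]

theorem cost_union_left {A B : Finset V} (h : Disjoint A B) (C : Finset V) :
    G.cost (A ∪ B) C = G.cost A C + G.cost B C := Finset.sum_union h

theorem cost_union_right {A B : Finset V} (h : Disjoint A B) (C : Finset V) :
    G.cost C (A ∪ B) = G.cost C A + G.cost C B := by
  simp only [G.cost_comm C, G.cost_union_left h]

variable [Fintype V]

/-- The cost of the cut `(X, V \ X)`. -/
noncomputable def cutCost (X : Finset V) : ℝ := G.cost X Xᶜ

theorem cutCost_compl (X : Finset V) : G.cutCost Xᶜ = G.cutCost X := by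
  rw [cutCost, cutCost, compl_compl, cost_comm]

theorem cutCost_eq_sum (X : Finset V) :
    G.cutCost X = ∑ a, ∑ b, if a ∈ X ∧ b ∉ X then G.weight a b else 0 := by
  simp [cutCost, cost_eq_sum_weight, ite_and, Finset.sum_ite,
    Finset.compl_eq_univ_sdiff, Finset.sdiff_eq_filter]

/-- Submodularity, checked for each ordered pair of vertices separately. -/
theorem cutCost_inter_add_union (A B : Finset V) :
    G.cutCost (A ∩ B) + G.cutCost (A ∪ B) ≤ G.cutCost A + G.cutCost B := by
  simp only [cutCost_eq_sum, ← Finset.sum_add_distrib]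
  refine Finset.sum_le_sum fun a _ => Finset.sum_le_sum fun b _ => ?_
  have := G.weight_nonneg a b
  by_cases a ∈ A <;> by_cases a ∈ B <;> by_cases b ∈ A <;> by_cases b ∈ B <;> simp [*]

/-- Posimodularity: submodularity for `A` and the complement of `B`. -/
theorem cutCost_sdiff_add_sdiff (A B : Finset V) :
    G.cutCost (A \ B) + G.cutCost (B \ A) ≤ G.cutCost A + G.cutCost B := by
  have h := G.cutCost_inter_add_union A Bᶜ
  have h₁ : A ∩ Bᶜ = A \ B := by ext; simp
  have h₂ : A ∪ Bᶜ = (B \ A)ᶜ := by ext; simp [imp_iff_not_or, or_comm]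
  rwa [h₁, h₂, cutCost_compl, cutCost_compl] at h

variable {G}

/-- Put X = S \ U: the two sides of the defining inequality differ by exactly d(S \ U) - d(S). -/
theorem isSCOf_iff {s : V} {S : Finset V} :
    G.IsSCOf s S ↔ s ∈ S ∧ ∀ X, s ∈ X → X ⊂ S → G.cutCost S < G.cutCost X := by
  have key : ∀ U ⊆ S, G.cutCost (S \ U) - G.cutCost S = G.cost U (S \ U) - G.cost U Sᶜ := by
    intro U hU
    have h₁ : (S \ U)ᶜ = Sᶜ ∪ U := by
      ext x; simp [imp_iff_not_or]
    have h₂ : G.cost S Sᶜ = G.cost (S \ U) Sᶜ + G.cost U Sᶜ := by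
      rw [← cost_union_left _ Finset.sdiff_disjoint, Finset.sdiff_union_of_subset hU]
    have h₃ : Disjoint Sᶜ U := (disjoint_compl_left (a := S)).mono_right hU
    rw [cutCost, cutCost, h₁, cost_union_right _ h₃, h₂, G.cost_comm (S \ U) U]
    ring
  refine and_congr_right fun hs => ⟨fun h X hsX hX => ?_, fun h U hU hne hsU => ?_⟩
  · have h₁ := h (S \ X) Finset.sdiff_subset (Finset.sdiff_nonempty.2 hX.2) (by simp [hsX])
    have h₂ := key (S \ X) Finset.sdiff_subset
    rw [Finset.sdiff_sdiff_eq_self hX.1] at h₂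
    rw [Finset.sdiff_sdiff_eq_self hX.1] at h₁
    linarith
  · have h₁ := h (S \ U) (by simp [hs, hsU]) (Finset.sdiff_ssubset hU hne)
    have h₂ := key U hU
    linarith

theorem IsSCOf.cutCost_lt {s : V} {S X : Finset V} (h : G.IsSCOf s S) (hs : s ∈ X)
    (hX : X ⊂ S) : G.cutCost S < G.cutCost X := (isSCOf_iff.1 h).2 X hs hX

theorem IsSCOf.cutCost_inter_lt {s : V} {S X : Finset V} (h : G.IsSCOf s S) (hs : s ∈ X)
    (hX : ¬ S ⊆ X) : G.cutCost S < G.cutCost (S ∩ X) :=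
  h.cutCost_lt (by simp [h.1, hs])
    ⟨Finset.inter_subset_left, fun h' => hX (h'.trans Finset.inter_subset_right)⟩

theorem IsSCOf.cutCost_sdiff_lt {s : V} {S X : Finset V} (h : G.IsSCOf s S) (hs : s ∉ X)
    (hX : ¬ Disjoint S X) : G.cutCost S < G.cutCost (S \ X) :=
  h.cutCost_lt (by simp [h.1, hs])
    ⟨Finset.sdiff_subset, fun h' => hX (Finset.disjoint_left.2 fun x hx hx' => by
      have := h' hx
      simp [hx'] at this)⟩

theorem isSC_singleton (v : V) : G.IsSC {v} := by
  refine ⟨v, isSCOf_iff.2 ⟨by simp, fun X hv hX => ?_⟩⟩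
  rw [Finset.ssubset_singleton_iff] at hX
  simp [hX] at hv

/-- Two source communities are disjoint if neither contains the source of the other. -/
theorem IsSCOf.disjoint {s s' : V} {S S' : Finset V} (h : G.IsSCOf s S) (h' : G.IsSCOf s' S')
    (hs : s ∉ S') (hs' : s' ∉ S) : Disjoint S S' := by
  by_contra hd
  -- Removing the overlap makes both sets strictly dearer, against posimodularity.
  have h₁ := h.cutCost_sdiff_lt hs hd
  have h₂ := h'.cutCost_sdiff_lt hs' (fun h => hd h.symm)
  have h₃ := G.cutCost_sdiff_add_sdiff S S'
  linarith

/-- Uncross X first with S' and then S with S' ∪ X. Both intersections contain the respective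
source, so they are no cheaper than S' and S. One of them is a proper subset because X is, which
makes the sum of the two inequalities strict. -/
theorem IsSCOf.union {s s' : V} {S S' : Finset V} (h : G.IsSCOf s S) (h' : G.IsSCOf s' S')
    (hs : s ∈ S') : G.IsSCOf s' (S ∪ S') := by
  refine isSCOf_iff.2 ⟨Finset.mem_union_right _ h'.1, fun X hX hlt => ?_⟩
  have h₁ := G.cutCost_inter_add_union S' X
  have h₂ := G.cutCost_inter_add_union S (S' ∪ X)
  have hU : S ∪ (S' ∪ X) = S ∪ S' := by
    rw [← Finset.union_assoc, Finset.union_eq_left.2 hlt.1]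
  rw [hU] at h₂
  have hs' : s ∈ S' ∪ X := Finset.mem_union_left _ hs
  by_cases c₁ : S' ⊆ X
  · rw [Finset.union_eq_right.2 c₁] at h₂ hs'
    have c₂ : ¬ S ⊆ X := fun c => hlt.2 (Finset.union_subset c c₁)
    have := h.cutCost_inter_lt hs' c₂
    linarith
  · have h₃ := h'.cutCost_inter_lt hX c₁
    by_cases c₂ : S ⊆ S' ∪ X
    · rw [Finset.inter_eq_left.2 c₂] at h₂
      linarith
    · have := h.cutCost_inter_lt hs' c₂
      linarith

theorem IsSC.union {S S' : Finset V} (h : G.IsSC S) (h' : G.IsSC S') (hd : ¬ Disjoint S S') :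
    G.IsSC (S ∪ S') := by
  obtain ⟨s, hs⟩ := h
  obtain ⟨s', hs'⟩ := h'
  by_cases c : s ∈ S'
  · exact ⟨s', hs.union hs' c⟩
  · by_cases c' : s' ∈ S
    · exact ⟨s, Finset.union_comm S S' ▸ hs'.union hs c'⟩
    · exact absurd (hs.disjoint hs' c c') hd

theorem IsSC.nonempty {S : Finset V} (h : G.IsSC S) : S.Nonempty := h.imp fun _ h => h.1

theorem IsMinCut.cutCost_le {s t : V} {X Y : Finset V} (h : G.IsMinCut s {t} X) (hs : s ∈ Y)
    (ht : t ∉ Y) : G.cutCost X ≤ G.cutCost Y := h.2 Y (separates_singleton.2 ⟨hs, ht⟩)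

theorem exists_isCommunity {s t : V} (hst : s ≠ t) : ∃ X, G.IsCommunity s {t} X := by
  classical
  obtain ⟨X, hX, hmin⟩ := Finset.exists_min_image
    (Finset.univ.filter fun X : Finset V => Separates s {t} X) (fun X => G.cost X Xᶜ)
    ⟨{s}, by simp [Separates, hst.symm]⟩
  obtain ⟨Y, hY, hmin'⟩ := Finset.exists_min_image
    (Finset.univ.filter fun X : Finset V => G.IsMinCut s {t} X) Finset.card
    ⟨X, by
      simp only [Finset.mem_filter, Finset.mem_univ, true_and] at hX hmin ⊢
      exact ⟨hX, hmin⟩⟩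
  simp only [Finset.mem_filter, Finset.mem_univ, true_and] at hY hmin'
  exact ⟨Y, hY, hmin'⟩

namespace IsCommunity

variable {s t : V} {S : Finset V}

theorem source_mem (h : G.IsCommunity s {t} S) : s ∈ S := h.1.1.1

theorem notMem (h : G.IsCommunity s {t} S) : t ∉ S := (separates_singleton.1 h.1.1).2

theorem cutCost_le (h : G.IsCommunity s {t} S) {Y : Finset V} (hs : s ∈ Y) (ht : t ∉ Y) :
    G.cutCost S ≤ G.cutCost Y := h.1.cutCost_le hs ht

/-- A proper subset around `s` that is not dearer would be a minimum cut with fewer vertices. -/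
theorem isSCOf (h : G.IsCommunity s {t} S) : G.IsSCOf s S := by
  refine isSCOf_iff.2 ⟨h.source_mem, fun X hs hX => ?_⟩
  by_contra hle
  have ht : t ∉ X := fun hc => h.notMem (hX.1 hc)
  have hmin : G.IsMinCut s {t} X := ⟨separates_singleton.2 ⟨hs, ht⟩, fun Y hY =>
    (not_lt.1 hle).trans (h.1.2 Y hY)⟩
  exact (h.2 X hmin).not_gt (Finset.card_lt_card hX)

theorem isSC (h : G.IsCommunity s {t} S) : G.IsSC S := ⟨s, h.isSCOf⟩

/-- A source community that avoids `t` is contained in `SC(s, t)` if its source is. -/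
theorem subset_of_isSCOf (h : G.IsCommunity s {t} S) {q : V} {Q : Finset V}
    (hQ : G.IsSCOf q Q) (hq : q ∈ S) (ht : t ∉ Q) : Q ⊆ S := by
  by_contra hc
  -- Since d(Q) < d(Q ∩ S), submodularity would make Q ∪ S a cheaper cut between `s` and `t` than S.
  have h₁ := hQ.cutCost_inter_lt hq hc
  have h₂ := G.cutCost_inter_add_union Q S
  have h₃ := h.cutCost_le (Y := Q ∪ S) (Finset.mem_union_right _ h.source_mem)
    (by simp [ht, h.notMem])
  linarith

theorem unique {S' : Finset V} (h : G.IsCommunity s {t} S) (h' : G.IsCommunity s {t} S') :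
    S = S' :=
  (h'.subset_of_isSCOf h.isSCOf h'.source_mem h.notMem).antisymm
    (h.subset_of_isSCOf h'.isSCOf h.source_mem h'.notMem)

theorem disjoint_opposite {S' : Finset V} (h : G.IsCommunity s {t} S)
    (h' : G.IsCommunity t {s} S') : Disjoint S S' :=
  h.isSCOf.disjoint h'.isSCOf h'.notMem h.notMem

theorem cutCost_opposite {S' : Finset V} (h : G.IsCommunity s {t} S)
    (h' : G.IsCommunity t {s} S') : G.cutCost S = G.cutCost S' := by
  refine le_antisymm ?_ ?_
  · rw [← G.cutCost_compl S']
    exact h.cutCost_le (by simp [h'.notMem]) (by simp [h'.source_mem])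
  · rw [← G.cutCost_compl S]
    exact h'.cutCost_le (by simp [h.notMem]) (by simp [h.source_mem])

end IsCommunity

end Cuts

end WGraph

namespace WGraph

variable {V : Type*}

/-! ### Rooted trees, their subtrees and components -/

namespace RootedTree

section

variable (T : RootedTree V) {v : V}

theorem iterate_parent_root (k : ℕ) : T.parent^[k] T.root = T.root :=
  Function.iterate_fixed T.parent_root k

/-- Going around the cycle often enough reaches the root, which is never left again. -/
theorem eq_root_of_iterate_eq {k : ℕ} (h : T.parent^[k + 1] v = v) : v = T.root := by
  obtain ⟨m, hm⟩ := T.reaches_root v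
  have h₁ : T.parent^[(k + 1) * m] v = v := by
    rw [Function.iterate_mul]
    exact Function.iterate_fixed h m
  have h₂ : (k + 1) * m = k * m + m := by ring
  rw [← h₁, h₂, Function.iterate_add_apply, hm, T.iterate_parent_root]

theorem toGraph_adj {u v : V} :
    T.toGraph.Adj u v ↔ u ≠ v ∧ (T.parent u = v ∨ T.parent v = u) := SimpleGraph.fromRel_adj _ _ _

theorem eq_of_mem_components {A C C' : Finset V} {x : V} (h : C ∈ T.components A)
    (h' : C' ∈ T.components A) (hx : x ∈ C) (hx' : x ∈ C') : C = C' := by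
  obtain ⟨K, hK⟩ := h
  obtain ⟨K', hK'⟩ := h'
  rw [← Finset.mem_coe, hK] at hx
  rw [← Finset.mem_coe, hK'] at hx'
  obtain ⟨y, hy, rfl⟩ := hx
  obtain ⟨y', hy', hyy⟩ := hx'
  obtain rfl := Subtype.ext hyy
  have : K = K' := (SimpleGraph.ConnectedComponent.mem_supp_iff _ _).1 hy ▸
    (SimpleGraph.ConnectedComponent.mem_supp_iff _ _).1 hy'
  rw [← Finset.coe_inj, hK, hK', this]

/-- Induction along the tree edges, from the root to the leaves. -/
theorem root_induction {p : V → Prop} (hroot : p T.root)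
    (step : ∀ v, v ≠ T.root → p (T.parent v) → p v) (v : V) : p v := by
  obtain ⟨k, hk⟩ := T.reaches_root v
  induction k generalizing v with
  | zero => exact (show v = T.root from hk) ▸ hroot
  | succ k ih =>
    by_cases hv : v = T.root
    · exact hv ▸ hroot
    · exact step v hv (ih _ hk)

end

section Subtrees

variable [Fintype V] (T : RootedTree V) {u v w x : V}

theorem mem_subtree : w ∈ T.subtree v ↔ ∃ k : ℕ, T.parent^[k] w = v := by
  simp [subtree]

theorem mem_subtree_self (v : V) : v ∈ T.subtree v := T.mem_subtree.2 ⟨0, rfl⟩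

theorem mem_subtree_root (v : V) : v ∈ T.subtree T.root := T.mem_subtree.2 (T.reaches_root v)

theorem mem_subtree_of_parent_mem (h : T.parent w ∈ T.subtree v) : w ∈ T.subtree v := by
  obtain ⟨k, hk⟩ := T.mem_subtree.1 h
  exact T.mem_subtree.2 ⟨k + 1, hk⟩

theorem parent_mem_subtree (h : w ∈ T.subtree v) (hne : w ≠ v) : T.parent w ∈ T.subtree v := by
  obtain ⟨k, hk⟩ := T.mem_subtree.1 h
  cases k with
  | zero => exact absurd hk hne
  | succ k => exact T.mem_subtree.2 ⟨k, hk⟩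

theorem mem_subtree_parent (v : V) : v ∈ T.subtree (T.parent v) := T.mem_subtree.2 ⟨1, rfl⟩

theorem mem_subtree_trans (h : u ∈ T.subtree v) (h' : v ∈ T.subtree w) : u ∈ T.subtree w := by
  obtain ⟨k, rfl⟩ := T.mem_subtree.1 h
  obtain ⟨l, rfl⟩ := T.mem_subtree.1 h'
  exact T.mem_subtree.2 ⟨l + k, Function.iterate_add_apply _ _ _ _⟩

theorem subtree_subset (h : v ∈ T.subtree w) : T.subtree v ⊆ T.subtree w :=
  fun _ hu => T.mem_subtree_trans hu h

theorem mem_subtree_antisymm (h : u ∈ T.subtree v) (h' : v ∈ T.subtree u) : u = v := by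
  obtain ⟨k, hk⟩ := T.mem_subtree.1 h
  obtain ⟨l, hl⟩ := T.mem_subtree.1 h'
  cases k with
  | zero => exact hk
  | succ k =>
    have hu : u = T.root := by
      refine T.eq_root_of_iterate_eq (k := l + k) ?_
      rw [Nat.add_assoc, Function.iterate_add_apply, hk, hl]
    rw [← hk, hu, T.iterate_parent_root]

theorem parent_notMem_subtree (hv : v ≠ T.root) : T.parent v ∉ T.subtree v := by
  intro h
  have := T.mem_subtree_antisymm h (T.mem_subtree_parent v)
  exact hv (T.eq_root_of_iterate_eq (k := 0) this)

theorem eq_root_of_root_mem_subtree (h : T.root ∈ T.subtree v) : v = T.root :=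
  T.mem_subtree_antisymm (T.mem_subtree_root v) h

theorem mem_subtree_total (h : u ∈ T.subtree v) (h' : u ∈ T.subtree w) :
    v ∈ T.subtree w ∨ w ∈ T.subtree v := by
  obtain ⟨k, rfl⟩ := T.mem_subtree.1 h
  obtain ⟨l, rfl⟩ := T.mem_subtree.1 h'
  rcases le_total k l with hkl | hkl <;> obtain ⟨m, rfl⟩ := Nat.exists_eq_add_of_le' hkl
  · exact .inl (T.mem_subtree.2 ⟨m, (Function.iterate_add_apply _ _ _ _).symm⟩)
  · exact .inr (T.mem_subtree.2 ⟨m, (Function.iterate_add_apply _ _ _ _).symm⟩)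

/-- Induction along the path from `u` to an ancestor. -/
theorem subtree_induction {p : V → Prop} (h : u ∈ T.subtree v) (hu : p u)
    (step : ∀ w, w ∈ T.subtree v → w ≠ v → u ∈ T.subtree w → p w → p (T.parent w)) : p v := by
  have key : ∀ k : ℕ, ∀ w, u ∈ T.subtree w → p w → T.parent^[k] w = v → p v := by
    intro k
    induction k with
    | zero => rintro w - hw rfl; exact hw
    | succ k ih =>
      intro w huw hw hk
      by_cases hwv : w = v
      · exact hwv ▸ hw
      · exact ih (T.parent w) (T.mem_subtree_trans huw (T.mem_subtree_parent w))
          (step w (T.mem_subtree.2 ⟨_, hk⟩) hwv huw hw) hk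
  obtain ⟨k, hk⟩ := T.mem_subtree.1 h
  exact key k u (T.mem_subtree_self u) hu hk

/-- If `u ∉ C` has an ancestor in `C`, then the path to it enters `C` along some tree edge. -/
theorem exists_entering_edge {C : Finset V} (h : u ∈ T.subtree v) (hu : u ∉ C) (hv : v ∈ C) :
    ∃ y, y ∉ C ∧ T.parent y ∈ C ∧ u ∈ T.subtree y ∧ y ∈ T.subtree v := by
  by_contra hc
  push Not at hc
  refine (T.subtree_induction (p := fun w => w ∉ C) h hu fun w hw _ huw hwC hp => ?_) hv
  exact hc w hwC hp huw hw

/-- `T[C]` is a subtree rooted in `r`. -/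
structure IsRootOf (T : RootedTree V) (r : V) (C : Finset V) : Prop where
  mem : r ∈ C
  subset : C ⊆ T.subtree r
  parent_mem : ∀ x ∈ C, x ≠ r → T.parent x ∈ C

namespace IsRootOf

variable {T} {r : V} {C : Finset V}

theorem unique {r' : V} (h : T.IsRootOf r C) (h' : r' ∈ C) (h'' : C ⊆ T.subtree r') : r = r' :=
  T.mem_subtree_antisymm (h'' h.mem) (h.subset h')

/-- `C` contains the path from each of its members to the root of `T[C]`. -/
theorem mem_of_between (h : T.IsRootOf r C) (hu : u ∈ C) (huv : u ∈ T.subtree v)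
    (hvr : v ∈ T.subtree r) : v ∈ C := by
  refine T.subtree_induction (p := fun w => w ∈ C) huv hu fun w hw hwv _ hwC =>
    h.parent_mem w hwC ?_
  rintro rfl
  exact hwv (T.mem_subtree_antisymm hw hvr)

theorem eq_of_root_mem (h : T.IsRootOf r C) (hroot : T.root ∈ C) : r = T.root :=
  T.eq_root_of_root_mem_subtree (h.subset hroot)

/-- A connected set that meets a subtree but is not contained in it contains the tree edge
above the subtree. -/
theorem mem_of_not_disjoint (h : T.IsRootOf r C) (hd : ¬ Disjoint C (T.subtree v))
    (hs : ¬ C ⊆ T.subtree v) : v ∈ C ∧ T.parent v ∈ C := by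
  obtain ⟨x, hx, hxv⟩ := Finset.not_disjoint_iff.1 hd
  have hr : r ∉ T.subtree v := fun hr => hs (h.subset.trans (T.subtree_subset hr))
  have hvr : v ∈ T.subtree r := (T.mem_subtree_total hxv (h.subset hx)).resolve_right hr
  have hv : v ∈ C := h.mem_of_between hx hxv hvr
  refine ⟨hv, h.parent_mem v hv ?_⟩
  rintro rfl
  exact hr (T.mem_subtree_self _)

end IsRootOf

theorem isRootOf_subtree (v : V) : T.IsRootOf v (T.subtree v) :=
  ⟨T.mem_subtree_self v, Finset.Subset.refl _, fun _ => T.parent_mem_subtree⟩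

theorem isRootOf_compl_subtree [DecidableEq V] (hv : v ≠ T.root) :
    T.IsRootOf T.root (T.subtree v)ᶜ :=
  ⟨Finset.mem_compl.2 fun h => hv (T.eq_root_of_root_mem_subtree h),
    fun _ _ => T.mem_subtree_root _, fun _ hx _ => Finset.mem_compl.2 fun h =>
      Finset.mem_compl.1 hx (T.mem_subtree_of_parent_mem h)⟩

/-- The vertices that are cut off before the set with a given index is deleted: none for the index
`none`, and the subtree of `r` for the index `some r`. -/
noncomputable def below : Option V → Finset V
  | none => ∅
  | some r => T.subtree r

theorem mem_below {c : Option V} : v ∈ T.below c ↔ ∃ b, c = some b ∧ v ∈ T.subtree b := by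
  cases c <;> simp [below]

end Subtrees

section Components

variable [Fintype V] (T : RootedTree V)

theorem IsRootOf.reachable {T : RootedTree V} {r x : V} {A C : Finset V} (h : T.IsRootOf r C)
    (hCA : C ⊆ A) (hx : x ∈ C) :
    (T.toGraph.induce (A : Set V)).Reachable ⟨x, hCA hx⟩ ⟨r, hCA h.mem⟩ := by
  have key : ∃ hr : r ∈ C, (T.toGraph.induce (A : Set V)).Reachable ⟨x, hCA hx⟩ ⟨r, hCA hr⟩ := by
    refine T.subtree_induction (p := fun w => ∃ hw : w ∈ C,
      (T.toGraph.induce (A : Set V)).Reachable ⟨x, hCA hx⟩ ⟨w, hCA hw⟩) (h.subset hx)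
      ⟨hx, .refl _⟩ ?_
    rintro w - hwr - ⟨hw, hxw⟩
    have hp := h.parent_mem w hw hwr
    refine ⟨hp, ?_⟩
    by_cases hpw : w = T.parent w
    · convert hxw using 2
      exact hpw.symm
    · refine hxw.trans (SimpleGraph.Adj.reachable ?_)
      exact T.toGraph_adj.2 ⟨hpw, .inl rfl⟩
  exact key.2

/-- A connected set that no edge of `T[A]` leaves is a component of `T[A]`. -/
theorem IsRootOf.mem_components {T : RootedTree V} {r : V} {A C : Finset V}
    (h : T.IsRootOf r C) (hCA : C ⊆ A) (hup : T.parent r ∈ A → T.parent r ∈ C)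
    (hdown : ∀ y ∈ A, T.parent y ∈ C → y ∈ C) : C ∈ T.components A := by
  refine ⟨(T.toGraph.induce (A : Set V)).connectedComponentMk ⟨r, hCA h.mem⟩, ?_⟩
  ext x
  simp only [Finset.mem_coe, Set.mem_image, SimpleGraph.ConnectedComponent.mem_supp_iff,
    SimpleGraph.ConnectedComponent.eq, Subtype.exists, exists_and_right, exists_eq_right]
  refine ⟨fun hx => ⟨hCA hx, h.reachable hCA hx⟩, ?_⟩
  rintro ⟨hxA, ⟨p⟩⟩
  -- No edge of `T[A]` enters `C` from outside, so a walk that ends in `C` also starts there.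
  have key : ∀ a b : (A : Set V), (T.toGraph.induce (A : Set V)).Walk a b → (b : V) ∈ C →
      (a : V) ∈ C := by
    intro a b p
    induction p with
    | nil => exact id
    | @cons a b c hab _ ih =>
      intro hc
      have hb := ih hc
      obtain ⟨-, hp | hp⟩ := T.toGraph_adj.1 (show T.toGraph.Adj a b from hab)
      · exact hdown a a.2 (hp ▸ hb)
      · by_cases hbr : (b : V) = r
        · rw [← hp, hbr]
          rw [hbr] at hp
          exact hup (hp ▸ a.2)
        · exact hp ▸ h.parent_mem b hb hbr
  exact key _ _ p h.mem

end Components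

end RootedTree

end WGraph

namespace WGraph

/-! ### Source communities in the cut tree -/

section CutTrees

variable {V : Type*} [Fintype V] [DecidableEq V] {G : WGraph V} {T : RootedTree V}

namespace IsCommunityCutTree

theorem isCommunity (hT : G.IsCommunityCutTree T) {v : V} (hv : v ≠ T.root) :
    G.IsCommunity v {T.parent v} (T.subtree v) := (hT v hv).1

theorem cutCost_le (hT : G.IsCommunityCutTree T) {v : V} (hv : v ≠ T.root) {X : Finset V}
    (h₁ : v ∈ X) (h₂ : T.parent v ∉ X) : G.cutCost (T.subtree v) ≤ G.cutCost X :=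
  (hT.isCommunity hv).cutCost_le h₁ h₂

theorem cutCost_le' (hT : G.IsCommunityCutTree T) {v : V} (hv : v ≠ T.root) {X : Finset V}
    (h₁ : v ∉ X) (h₂ : T.parent v ∈ X) : G.cutCost (T.subtree v) ≤ G.cutCost X := by
  rw [← G.cutCost_compl X]
  exact hT.cutCost_le hv (by simpa) (by simpa)

/-- A source community that avoids `v` is contained in the subtree of `v` or disjoint from it. -/
theorem subset_or_disjoint (hT : G.IsCommunityCutTree T) {s v : V} {S : Finset V}
    (hS : G.IsSCOf s S) (hv : v ≠ T.root) (h : v ∉ S) :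
    S ⊆ T.subtree v ∨ Disjoint S (T.subtree v) := by
  by_cases hs : s ∈ T.subtree v
  · have hne : s ≠ v := fun hsv => h (hsv ▸ hS.1)
    -- `w` is the child of `v` above the source, and its subtree is SC(w, v), where v ∉ S.
    obtain ⟨w, hwv, hpw, hsw, -⟩ := T.exists_entering_edge (C := {v}) hs (by simpa) (by simp)
    obtain rfl := Finset.mem_singleton.1 hpw
    have hw : w ≠ T.root := by
      rintro rfl
      exact hwv (Finset.mem_singleton.2 T.parent_root.symm)
    exact .inl (((hT.isCommunity hw).subset_of_isSCOf hS hsw h).trans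
      (T.subtree_subset (T.mem_subtree_parent w)))
  · exact .inr (hS.disjoint (hT.isCommunity hv).isSCOf hs h)

/-- A source community induces a subtree of the cut tree. -/
theorem exists_isRootOf (hT : G.IsCommunityCutTree T) {S : Finset V} (hS : G.IsSC S) :
    ∃ r, T.IsRootOf r S := by
  obtain ⟨s, hs⟩ := hS
  -- Either the whole path from the source to the root lies in `S`, or it leaves `S` along an edge
  -- above some `y`; then `S` lies below `y`. In both cases a parent outside `S` contradicts
  -- `subset_or_disjoint`.
  by_cases hc : ∀ v, s ∈ T.subtree v → v ∈ S
  · refine ⟨T.root, hc _ (T.mem_subtree_root s), fun x _ => T.mem_subtree_root x,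
      fun x hx _ => ?_⟩
    by_contra hp
    have hpr : T.parent x ≠ T.root := fun h => hp (h ▸ hc _ (T.mem_subtree_root s))
    rcases hT.subset_or_disjoint hs hpr hp with h | h
    · exact hp (hc _ (h hs.1))
    · exact Finset.disjoint_left.1 h hx (T.mem_subtree_parent x)
  · push Not at hc
    obtain ⟨v, hsv, hv⟩ := hc
    obtain ⟨y, hy, hyS, hsy, -⟩ := T.exists_entering_edge (C := Sᶜ) hsv
      (by simpa using hs.1) (by simpa using hv)
    rw [Finset.mem_compl, not_not] at hy
    rw [Finset.mem_compl] at hyS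
    have hyr : y ≠ T.root := by
      rintro rfl
      exact hyS (T.parent_root.symm ▸ hy)
    have hsub := (hT.isCommunity hyr).subset_of_isSCOf hs hsy hyS
    refine ⟨y, hy, hsub, fun x hx hxy => ?_⟩
    by_contra hp
    have hpr : T.parent x ≠ T.root := by
      intro h
      exact hyr (T.eq_root_of_root_mem_subtree (h ▸ T.parent_mem_subtree (hsub hx) hxy))
    rcases hT.subset_or_disjoint hs hpr hp with h | h
    · have h₁ := T.parent_mem_subtree (hsub hx) hxy
      have := T.mem_subtree_antisymm h₁ (h hy)
      exact hp (this ▸ hy)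
    · exact Finset.disjoint_left.1 h hx (T.mem_subtree_parent x)

/-- A source community that contains the parent of `r` and avoids the subtree of `r` is contained
in the opposite source community `SC(parent r, r)`. -/
theorem subset_opposite (hT : G.IsCommunityCutTree T) {r : V} (hr : r ≠ T.root)
    {O Q : Finset V} (hO : G.IsCommunity (T.parent r) {r} O) (hQ : G.IsSC Q)
    (hd : Disjoint Q (T.subtree r)) (hp : T.parent r ∈ Q) : Q ⊆ O := by
  obtain ⟨q, hq⟩ := hQ
  have hrQ : r ∉ Q := fun h => Finset.disjoint_left.1 hd h (T.mem_subtree_self r)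
  by_cases hqO : q ∈ O
  · exact hO.subset_of_isSCOf hq hqO hrQ
  exfalso
  obtain ⟨r', hr'⟩ := hT.exists_isRootOf hO.isSC
  have hpO := hO.source_mem
  by_cases hc : q ∈ T.subtree r'
  -- The source of Q lies in the subtree D of some y that hangs from O. Then Q ∪ D is an SC with
  -- source y, so d(Q ∪ D) < d(D) ≤ d(O), although Q ∪ D separates `parent r` from `r`.
  · obtain ⟨y, hyO, hxO, hqy, hyr'⟩ := T.exists_entering_edge hc hqO hr'.mem
    have hyroot : y ≠ T.root := by
      rintro rfl
      exact hyO (T.parent_root ▸ hxO)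
    have hpy : T.parent r ∉ T.subtree y := fun h => hyO (hr'.mem_of_between hpO h hyr')
    have hry : r ∉ T.subtree y := by
      intro h
      by_cases hry : r = y
      · exact Finset.disjoint_left.1 hd hq.1 (hry ▸ hqy)
      · exact hpy (T.parent_mem_subtree h hry)
    have hU := hq.union (hT.isCommunity hyroot).isSCOf hqy
    have h₁ := hU.cutCost_lt (T.mem_subtree_self y)
      ⟨Finset.subset_union_right, fun h => hpy (h (Finset.mem_union_left _ hp))⟩
    have h₂ := hT.cutCost_le' hyroot hyO hxO
    have h₃ := hO.cutCost_le (Y := Q ∪ T.subtree y) (Finset.mem_union_left _ hp)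
      (by simp [hrQ, hry])
    linarith
  -- The source of Q lies outside the subtree D of the root of O. Posimodularity gives d(D \ Q) <
  -- d(D) ≤ d(O), although D \ Q separates `r` from `parent r` and the two opposite minimum cuts
  -- have equal cost.
  · have hroot : r' ≠ T.root := by
      rintro rfl
      exact hc (T.mem_subtree_root q)
    have hpr' : T.parent r' ∉ O := fun h => T.parent_notMem_subtree hroot (hr'.subset h)
    have hpD : T.parent r ∈ T.subtree r' := hr'.subset hpO
    have h₁ := hT.cutCost_le hroot hr'.mem hpr'
    have h₂ := hq.cutCost_sdiff_lt hc (Finset.not_disjoint_iff.2 ⟨_, hp, hpD⟩)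
    have h₃ := G.cutCost_sdiff_add_sdiff Q (T.subtree r')
    have h₄ := hT.cutCost_le (X := T.subtree r' \ Q) hr
      (by simp [hrQ, T.mem_subtree_of_parent_mem hpD]) (by simp [hp])
    have h₅ := (hT.isCommunity hr).cutCost_opposite hO
    linarith

end IsCommunityCutTree

end CutTrees

/-! ### The maximal clustering -/

section Clusterings

variable {V : Type*} [Fintype V] [DecidableEq V] {G : WGraph V} {S : Finset V}

/-- `C` is inclusion-maximal among the source communities that are disjoint from `S`. -/
def IsMaxSC (G : WGraph V) (S C : Finset V) : Prop :=
  Maximal (fun Q => G.IsSC Q ∧ Disjoint Q S) C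

theorem exists_isMaxSC {Q : Finset V} (hQ : G.IsSC Q) (hd : Disjoint Q S) :
    ∃ C, G.IsMaxSC S C ∧ Q ⊆ C := by
  obtain ⟨C, hC, hmax⟩ := (Set.toFinite {Q | G.IsSC Q ∧ Disjoint Q S}).exists_le_maximal
    (show Q ∈ {Q | G.IsSC Q ∧ Disjoint Q S} from ⟨hQ, hd⟩)
  exact ⟨C, hmax, hC⟩

/-- The union of both is an SC disjoint from S, so maximality absorbs it. -/
theorem IsMaxSC.subset_of_not_disjoint {C Q : Finset V} (hC : G.IsMaxSC S C) (hQ : G.IsSC Q)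
    (hd : Disjoint Q S) (hCQ : ¬ Disjoint Q C) : Q ⊆ C :=
  Finset.subset_union_left.trans
    (hC.2 ⟨hQ.union hC.1.1 hCQ, Finset.disjoint_union_left.2 ⟨hd, hC.1.2⟩⟩
      Finset.subset_union_right)

theorem IsMaxSC.eq_of_not_disjoint {C C' : Finset V} (hC : G.IsMaxSC S C)
    (hC' : G.IsMaxSC S C') (hd : ¬ Disjoint C C') : C = C' :=
  (hC'.subset_of_not_disjoint hC.1.1 hC.1.2 hd).antisymm
    (hC.subset_of_not_disjoint hC'.1.1 hC'.1.2 fun h => hd h.symm)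

open Classical in
/-- The clustering `Ω(S)`: besides `S`, its clusters are the maximal source communities that are
disjoint from `S`. -/
noncomputable def maxClustering (G : WGraph V) {S : Finset V} (hS : S.Nonempty) :
    Finpartition (Finset.univ : Finset V) :=
  Finpartition.ofExistsUnique
    (Finset.univ.filter fun C => C = S ∨ G.IsMaxSC S C)
    (fun _ _ => Finset.subset_univ _)
    (fun x _ => by
      simp only [Finset.mem_filter, Finset.mem_univ, true_and]
      by_cases hx : x ∈ S
      · refine ⟨S, ⟨.inl rfl, hx⟩, ?_⟩
        rintro C ⟨rfl | hC, hxC⟩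
        · rfl
        · exact absurd hx (Finset.disjoint_left.1 hC.1.2 hxC)
      · obtain ⟨C, hC, hxC⟩ := exists_isMaxSC (S := S) (G.isSC_singleton x) (by simpa)
        rw [Finset.singleton_subset_iff] at hxC
        refine ⟨C, ⟨.inr hC, hxC⟩, ?_⟩
        rintro C' ⟨rfl | hC', hxC'⟩
        · exact absurd hxC' hx
        · exact hC'.eq_of_not_disjoint hC (Finset.not_disjoint_iff.2 ⟨x, hxC', hxC⟩))
    (by
      simp only [Finset.mem_filter, Finset.mem_univ, true_and, not_or]
      refine ⟨fun h => hS.ne_empty h.symm, fun h => ?_⟩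
      simpa using h.1.1.nonempty)

theorem mem_maxClustering (hS : S.Nonempty) {C : Finset V} :
    C ∈ (G.maxClustering hS).parts ↔ C = S ∨ G.IsMaxSC S C := by
  simp [maxClustering, Finpartition.ofExistsUnique]

theorem isSCClustering_maxClustering (hS : S.Nonempty) :
    G.IsSCClustering S (G.maxClustering hS) :=
  ⟨(mem_maxClustering hS).2 (.inl rfl), fun _ hC hne =>
    (((mem_maxClustering hS).1 hC).resolve_left hne).1.1⟩

theorem exists_subset_maxClustering (hS : S.Nonempty) {Q : Finset V} (hQ : G.IsSC Q)
    (hd : Disjoint Q S) : ∃ C ∈ (G.maxClustering hS).parts, Q ⊆ C := by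
  obtain ⟨C, hC, hQC⟩ := exists_isMaxSC hQ hd
  exact ⟨C, (mem_maxClustering hS).2 (.inr hC), hQC⟩

theorem IsSCClustering.le_maxClustering (hS : S.Nonempty)
    {Ω : Finpartition (Finset.univ : Finset V)} (hΩ : G.IsSCClustering S Ω) :
    Ω ≤ G.maxClustering hS := by
  intro C hC
  by_cases hCS : C = S
  · exact ⟨S, (mem_maxClustering hS).2 (.inl rfl), hCS.le⟩
  · exact exists_subset_maxClustering hS (hΩ.2 C hC hCS) (Ω.disjoint hC hΩ.1 hCS)

theorem not_disjoint_of_mem_maxClustering (hS : S.Nonempty) {C Q : Finset V}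
    (hC : C ∈ (G.maxClustering hS).parts) (hQ : G.IsSC Q) (hd : Disjoint Q S)
    (h : ¬ Disjoint Q C) : Q ⊆ C := by
  rcases (mem_maxClustering hS).1 hC with rfl | hC
  · exact absurd hd h
  · exact hC.subset_of_not_disjoint hQ hd h

end Clusterings

end WGraph

namespace WGraph

/-! ### The chain of deleted sets, all of which are clusters -/

section Chains

variable {V : Type*} [Fintype V] [DecidableEq V] {G : WGraph V} {T : RootedTree V}
  {S X : Finset V} {c : Option V}

/-- The sets that the decomposition of the cut tree deletes one after the other. The index is
`none` for `S`, and `some r` for `SC(parent r, r)`. -/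
inductive OppositeChain (G : WGraph V) (T : RootedTree V) (S : Finset V) :
    Option V → Finset V → Prop
  | base : OppositeChain G T S none S
  | step {c : Option V} {X X' : Finset V} {r : V} (h : OppositeChain G T S c X)
      (hr : T.IsRootOf r X) (hroot : T.root ∉ X) (hX' : G.IsCommunity (T.parent r) {r} X') :
      OppositeChain G T S (some r) X'

namespace OppositeChain

theorem isSC (hS : G.IsSC S) (h : G.OppositeChain T S c X) : G.IsSC X := by
  cases h with
  | base => exact hS
  | step _ _ _ hX' => exact hX'.isSC

theorem edge {b : V} (h : G.OppositeChain T S (some b) X) :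
    b ≠ T.root ∧ T.parent b ∈ X ∧ b ∉ X := by
  cases h with
  | step _ hr hroot hX' =>
    refine ⟨?_, hX'.source_mem, hX'.notMem⟩
    rintro rfl
    exact hroot hr.mem

theorem disjoint_below (hT : G.IsCommunityCutTree T) (h : G.OppositeChain T S c X) :
    Disjoint X (T.below c) := by
  cases h with
  | base => exact Finset.disjoint_empty_right _
  | step h' hr hroot hX' =>
    exact hX'.disjoint_opposite (hT.isCommunity (h'.step hr hroot hX').edge.1)

theorem below_subset (h : G.OppositeChain T S c X) {r : V} (hr : T.IsRootOf r X) :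
    T.below c ⊆ T.subtree r := by
  cases c with
  | none => exact Finset.empty_subset _
  | some b => exact T.subtree_subset (T.mem_subtree_of_parent_mem (hr.subset h.edge.2.1))

theorem subset_union_below (h : G.OppositeChain T S c X) : S ⊆ X ∪ T.below c := by
  induction h with
  | base => exact Finset.subset_union_left
  | step h' hr _ _ ih =>
    exact (ih.trans (Finset.union_subset hr.subset (h'.below_subset hr))).trans
      Finset.subset_union_right

theorem subset_below {b : V} (h : G.OppositeChain T S (some b) X) : S ⊆ T.subtree b := by
  cases h with
  | step h' hr _ _ =>
    exact h'.subset_union_below.trans (Finset.union_subset hr.subset (h'.below_subset hr))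

/-- Equal sets get equal codes. Two indices b, b' of X are comparable, as both are ancestors of S.
If b lay strictly below b', then `parent b` would be both in X and in the subtree of b', which X
avoids. -/
theorem index_unique (hT : G.IsCommunityCutTree T) (hS : S.Nonempty) {c' : Option V}
    (h : G.OppositeChain T S c X) (h' : G.OppositeChain T S c' X) : c = c' := by
  obtain ⟨s, hs⟩ := hS
  have key₁ : ∀ b, G.OppositeChain T S (some b) X → ¬ G.OppositeChain T S none X := by
    rintro b hb ⟨⟩
    exact Finset.disjoint_left.1 (hb.disjoint_below hT) hs (hb.subset_below hs)
  have key₂ : ∀ b b', G.OppositeChain T S (some b) X → G.OppositeChain T S (some b') X →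
      b ∈ T.subtree b' → b = b' := by
    intro b b' hb hb' hbb
    by_contra hne
    exact Finset.disjoint_left.1 (hb'.disjoint_below hT) hb.edge.2.1
      (T.parent_mem_subtree hbb hne)
  cases c with
  | none =>
    cases c' with
    | none => rfl
    | some b' => exact absurd h (key₁ b' h')
  | some b =>
    cases c' with
    | none => exact absurd h' (key₁ b h)
    | some b' =>
      rcases T.mem_subtree_total (h.subset_below hs) (h'.subset_below hs) with hb | hb
      · rw [key₂ b b' h h' hb]
      · rw [key₂ b' b h' h hb]

theorem mem_maxClustering (hT : G.IsCommunityCutTree T) (hS : G.IsSC S)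
    (h : G.OppositeChain T S c X) : X ∈ (G.maxClustering hS.nonempty).parts := by
  induction h with
  | base => exact (WGraph.mem_maxClustering _).2 (.inl rfl)
  | @step c X X' r h' hr hroot hX' ih =>
    have hchain := h'.step hr hroot hX'
    have hrr : r ≠ T.root := hchain.edge.1
    have hdX' : Disjoint X' (T.subtree r) := hchain.disjoint_below hT
    refine (WGraph.mem_maxClustering _).2 (.inr ⟨⟨hX'.isSC, ?_⟩, ?_⟩)
    · exact hdX'.mono_right hchain.subset_below
    · rintro Q ⟨hQ, hd⟩ hle
      -- If Q met the subtree of `r`, it would contain `r` by connectedness and so lie in the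
      -- cluster X. But X does not contain `parent r`.
      have hp : T.parent r ∈ Q := hle hX'.source_mem
      refine hT.subset_opposite hrr hX' hQ ?_ hp
      by_contra hnd
      obtain ⟨t, ht⟩ := hT.exists_isRootOf hQ
      have hpr := T.parent_notMem_subtree hrr
      have hrQ := (ht.mem_of_not_disjoint hnd fun hs => hpr (hs hp)).1
      have := not_disjoint_of_mem_maxClustering _ ih hQ hd
        (Finset.not_disjoint_iff.2 ⟨r, hrQ, hr.mem⟩)
      exact hpr (hr.subset (this hp))

theorem disjoint_subtree (hT : G.IsCommunityCutTree T) (hS : G.IsSC S)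
    (h : G.OppositeChain T S c X) {v : V} (hv : v ∉ X) (hvb : v ∉ T.below c)
    (hp : T.parent v ∈ X) : Disjoint (T.subtree v) (X ∪ T.below c) := by
  obtain ⟨r, hr⟩ := hT.exists_isRootOf (h.isSC hS)
  have hdX : ∀ x ∈ X, x ∉ T.subtree v := fun x hx hxv =>
    hv (hr.mem_of_between hx hxv (T.mem_subtree_of_parent_mem (hr.subset hp)))
  refine Finset.disjoint_left.2 fun x hxv hx => ?_
  rcases Finset.mem_union.1 hx with hx | hx
  · exact hdX x hx hxv
  · obtain ⟨b, rfl, hxb⟩ := T.mem_below.1 hx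
    rcases T.mem_subtree_total hxv hxb with hvb' | hbv
    · exact hvb hvb'
    · by_cases hbv' : b = v
      · exact hvb (hbv' ▸ T.mem_subtree_self b)
      · exact hdX _ h.edge.2.1 (T.parent_mem_subtree hbv hbv')

/-- A larger SC disjoint from S would contain `parent v`, hence lie inside the cluster X, which
misses `v`. -/
theorem subtree_mem_maxClustering (hT : G.IsCommunityCutTree T) (hS : G.IsSC S)
    (h : G.OppositeChain T S c X) {v : V} (hv : v ∉ X) (hvb : v ∉ T.below c)
    (hp : T.parent v ∈ X) : T.subtree v ∈ (G.maxClustering hS.nonempty).parts := by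
  have hvr : v ≠ T.root := by
    rintro rfl
    exact hv (T.parent_root ▸ hp)
  have hd := h.disjoint_subtree hT hS hv hvb hp
  refine (WGraph.mem_maxClustering _).2
    (.inr ⟨⟨(hT.isCommunity hvr).isSC, hd.mono_right h.subset_union_below⟩, ?_⟩)
  rintro Q ⟨hQ, hdQ⟩ hle
  by_contra hc
  obtain ⟨t, ht⟩ := hT.exists_isRootOf hQ
  have hvv := T.mem_subtree_self v
  have hpQ := (ht.mem_of_not_disjoint (Finset.not_disjoint_iff.2 ⟨v, hle hvv, hvv⟩) hc).2
  exact hv (not_disjoint_of_mem_maxClustering _ (h.mem_maxClustering hT hS) hQ hdQ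
    (Finset.not_disjoint_iff.2 ⟨_, hpQ, hp⟩) (hle hvv))

/-- Below the root of the deleted set, whatever is not in it and was not cut off before lies in
subtrees that are attached to it. -/
theorem exists_attached_subtree (hT : G.IsCommunityCutTree T) (hS : G.IsSC S)
    (h : G.OppositeChain T S c X) {r v : V} (hr : T.IsRootOf r X) (hvr : v ∈ T.subtree r)
    (hv : v ∉ X) (hvb : v ∉ T.below c) :
    ∃ u, u ∉ X ∧ u ∉ T.below c ∧ T.parent u ∈ X ∧ v ∈ T.subtree u ∧
      T.subtree u ∈ (G.maxClustering hS.nonempty).parts := by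
  obtain ⟨u, hu, hpu, hvu, -⟩ := T.exists_entering_edge hvr hv hr.mem
  have hub : u ∉ T.below c := by
    intro hub
    obtain ⟨b, rfl, hb⟩ := T.mem_below.1 hub
    exact hvb (T.mem_subtree_trans hvu hb)
  exact ⟨u, hu, hub, hpu, hvu, h.subtree_mem_maxClustering hT hS hu hub hpu⟩

end OppositeChain

end Chains

/-! ### The decomposition yields the maximal clustering -/

section Peeling

variable {V : Type*} [Fintype V] [DecidableEq V] {G : WGraph V} {T : RootedTree V}
  {S X : Finset V} {c : Option V}

/-- The root of `T[S]`, the component of the tree root and the opposite SC are all forced. -/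
theorem Peel.unique {A : Finset V} {𝒞 𝒞' : Set (Finset V)} (h : G.Peel T A S 𝒞)
    (h' : G.Peel T A S 𝒞') : 𝒞 = 𝒞' := by
  induction h generalizing 𝒞' with
  | last hroot =>
    cases h' with
    | last => rfl
    | step hroot' => exact absurd hroot hroot'
  | step hroot hr hSr hA hrootA hS _ ih =>
    cases h' with
    | last hroot' => exact absurd hroot' hroot
    | step _ hr' hSr' hA' hrootA' hS' hrec' =>
      obtain rfl := T.mem_subtree_antisymm (hSr' hr) (hSr hr')
      obtain rfl := T.eq_of_mem_components hA hA' hrootA hrootA'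
      obtain rfl := hS.unique hS'
      rw [ih hrec']

namespace OppositeChain

theorem subtree_mem_components (hT : G.IsCommunityCutTree T) (hS : G.IsSC S)
    (h : G.OppositeChain T S c X) {v : V} (hv : v ∉ X) (hvb : v ∉ T.below c)
    (hp : T.parent v ∈ X) : T.subtree v ∈ T.components ((T.below c)ᶜ \ X) := by
  refine (T.isRootOf_subtree v).mem_components (fun x hx => ?_) (fun hc => ?_)
    fun _ _ => T.mem_subtree_of_parent_mem
  · have := Finset.disjoint_left.1 (h.disjoint_subtree hT hS hv hvb hp) hx
    simpa [not_or, and_comm] using this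
  · simp [hp] at hc

theorem compl_subtree_mem_components (h : G.OppositeChain T S c X) {r : V}
    (hr : T.IsRootOf r X) (hroot : r ≠ T.root) :
    (T.subtree r)ᶜ ∈ T.components ((T.below c)ᶜ \ X) := by
  refine (T.isRootOf_compl_subtree hroot).mem_components (fun x hx => ?_) (fun _ => ?_) ?_
  · simp only [Finset.mem_sdiff, Finset.mem_compl] at hx ⊢
    exact ⟨fun hc => hx (h.below_subset hr hc), fun hc => hx (hr.subset hc)⟩
  · rw [T.parent_root]
    exact (T.isRootOf_compl_subtree hroot).mem
  · intro y hy hpy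
    simp only [Finset.mem_sdiff, Finset.mem_compl] at hy hpy ⊢
    intro hyr
    refine hpy (T.parent_mem_subtree hyr ?_)
    rintro rfl
    exact hy.2 hr.mem

theorem mem_of_mem_components (hT : G.IsCommunityCutTree T) (hS : G.IsSC S)
    (h : G.OppositeChain T S c X) {r : V} (hr : T.IsRootOf r X) {C : Finset V}
    (hC : C ∈ T.components ((T.below c)ᶜ \ X)) (hne : C ≠ (T.subtree r)ᶜ) :
    C ∈ (G.maxClustering hS.nonempty).parts := by
  obtain ⟨x, hx, hxA⟩ : ∃ x, x ∈ C ∧ x ∈ (T.below c)ᶜ \ X := by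
    obtain ⟨K, hK⟩ := hC
    obtain ⟨y, hy⟩ := K.nonempty_supp
    exact ⟨y, by rw [← Finset.mem_coe, hK]; exact ⟨y, hy, rfl⟩, y.2⟩
  simp only [Finset.mem_sdiff, Finset.mem_compl] at hxA
  by_cases hxr : x ∈ T.subtree r
  · obtain ⟨u, hu, hub, hpu, hxu, hmem⟩ := h.exists_attached_subtree hT hS hr hxr hxA.2 hxA.1
    rwa [T.eq_of_mem_components hC (h.subtree_mem_components hT hS hu hub hpu) hx hxu]
  · have hroot : r ≠ T.root := by
      rintro rfl
      exact hxr (T.mem_subtree_root x)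
    exact absurd (T.eq_of_mem_components hC (h.compl_subtree_mem_components hr hroot) hx
      (Finset.mem_compl.2 hxr)) hne

theorem exists_peel (hT : G.IsCommunityCutTree T) (hS : G.IsSC S)
    (h : G.OppositeChain T S c X) : ∃ 𝒞, G.Peel T (T.below c)ᶜ X 𝒞 ∧
      (∀ C ∈ 𝒞, C ∈ (G.maxClustering hS.nonempty).parts) ∧
      ∀ x, x ∉ T.below c → ∃ C ∈ 𝒞, x ∈ C := by
  -- The component still to be decomposed is the complement of the last cut-off subtree. It shrinks,
  -- since it loses the root of X.
  induction hn : (T.below c)ᶜ.card using Nat.strong_induction_on generalizing c X with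
  | _ n ih =>
  obtain ⟨r, hr⟩ := hT.exists_isRootOf (h.isSC hS)
  by_cases hroot : T.root ∈ X
  · refine ⟨_, .last hroot, ?_, fun x hx => ?_⟩
    · rintro C (rfl | hC)
      · exact h.mem_maxClustering hT hS
      · refine h.mem_of_mem_components hT hS hr hC ?_
        rintro rfl
        obtain rfl := hr.eq_of_root_mem hroot
        obtain ⟨K, hK⟩ := hC
        obtain ⟨y, hy⟩ := K.nonempty_supp
        have hy' : (y : V) ∈ ((T.subtree T.root)ᶜ : Finset V) := by
          rw [← Finset.mem_coe, hK]
          exact ⟨y, hy, rfl⟩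
        exact Finset.mem_compl.1 hy' (T.mem_subtree_root _)
    · by_cases hxX : x ∈ X
      · exact ⟨X, .inl rfl, hxX⟩
      · obtain rfl := hr.eq_of_root_mem hroot
        obtain ⟨u, hu, hub, hpu, hxu, -⟩ := h.exists_attached_subtree hT hS hr
          (T.mem_subtree_root x) hxX hx
        exact ⟨_, .inr (h.subtree_mem_components hT hS hu hub hpu), hxu⟩
  · have hrr : r ≠ T.root := by
      rintro rfl
      exact hroot hr.mem
    obtain ⟨X', hX'⟩ := exists_isCommunity (G := G) (s := T.parent r) (t := r)
      fun hc => T.parent_notMem_subtree hrr (hc.symm ▸ T.mem_subtree_self r)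
    have hnext := h.step hr hroot hX'
    have hlt : (T.subtree r)ᶜ.card < n := by
      rw [← hn]
      refine Finset.card_lt_card (Finset.compl_ssubset_compl.2 ⟨h.below_subset hr, fun hc => ?_⟩)
      exact Finset.disjoint_left.1 (h.disjoint_below hT) hr.mem (hc (T.mem_subtree_self r))
    obtain ⟨𝒞, hpeel, hparts, hcover⟩ := ih _ hlt hnext rfl
    refine ⟨_, .step hroot hr.mem hr.subset (h.compl_subtree_mem_components hr hrr)
      (T.isRootOf_compl_subtree hrr).mem hX' hpeel, ?_, fun x hx => ?_⟩
    · rintro C ((rfl | hC) | hC)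
      · exact h.mem_maxClustering hT hS
      · exact h.mem_of_mem_components hT hS hr hC.1 hC.2
      · exact hparts C hC
    · by_cases hxr : x ∈ T.subtree r
      · by_cases hxX : x ∈ X
        · exact ⟨X, .inl (.inl rfl), hxX⟩
        · obtain ⟨u, hu, hub, hpu, hxu, -⟩ := h.exists_attached_subtree hT hS hr hxr hxX hx
          refine ⟨_, .inl (.inr ⟨h.subtree_mem_components hT hS hu hub hpu, fun hc => ?_⟩), hxu⟩
          exact Finset.mem_compl.1 ((Set.mem_singleton_iff.1 hc) ▸ hxu) hxr
      · obtain ⟨C, hC, hxC⟩ := hcover x hxr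
        exact ⟨C, .inr hC, hxC⟩

end OppositeChain

/-- A family of clusters that covers V contains every cluster, as clusters are nonempty and
disjoint. -/
theorem peel_iff (hT : G.IsCommunityCutTree T) (hS : G.IsSC S) (𝒞 : Set (Finset V)) :
    G.Peel T Finset.univ S 𝒞 ↔ 𝒞 = (G.maxClustering hS.nonempty).parts := by
  obtain ⟨𝒟, hpeel, hparts, hcover⟩ :=
    (OppositeChain.base (G := G) (T := T) (S := S)).exists_peel hT hS
  have h𝒟 : 𝒟 = (G.maxClustering hS.nonempty).parts := by
    refine Set.Subset.antisymm hparts fun C hC => ?_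
    obtain ⟨x, hx⟩ := (G.maxClustering hS.nonempty).nonempty_of_mem_parts hC
    obtain ⟨D, hD, hxD⟩ := hcover x (by simp [RootedTree.below])
    rwa [(G.maxClustering hS.nonempty).eq_of_mem_parts hC (hparts D hD) hx hxD]
  have hu : (T.below none)ᶜ = Finset.univ := by simp [RootedTree.below]
  rw [hu] at hpeel
  rw [← h𝒟]
  exact ⟨fun h => h.unique hpeel, fun h => h ▸ hpeel⟩

end Peeling

end WGraph

namespace RAM

/-! ### Total correctness with running times -/

section Calculus

variable {I : Input} {p q : Prog} {Q : ℕ → State → Prop} {σ : State} {b : Test}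

/-- Started in `σ`, the program `p` halts, and its running time and final state satisfy `Q`. -/
def Ensures (I : Input) (p : Prog) (Q : ℕ → State → Prop) (σ : State) : Prop :=
  ∃ t τ, Exec I p σ t τ ∧ Q t τ

theorem Ensures.mono {Q' : ℕ → State → Prop} (h : Ensures I p Q σ)
    (hQ : ∀ t τ, Q t τ → Q' t τ) : Ensures I p Q' σ :=
  h.imp fun t => Exists.imp fun τ h => ⟨h.1, hQ t τ h.2⟩

/-- This and the next equivalences are weakest-precondition rules: rewriting with them executes
loop-free code symbolically. -/
theorem ensures_skip : Ensures I .skip Q σ ↔ Q 0 σ :=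
  ⟨fun ⟨_, _, h, hQ⟩ => by cases h; exact hQ, fun h => ⟨_, _, .skip σ, h⟩⟩

theorem ensures_instr {c : Instr} : Ensures I (.instr c) Q σ ↔ Q 1 (c.run I σ) :=
  ⟨fun ⟨_, _, h, hQ⟩ => by cases h; exact hQ, fun h => ⟨_, _, .instr c σ, h⟩⟩

theorem ensures_seq :
    Ensures I (.seq p q) Q σ ↔ Ensures I p (fun t => Ensures I q fun u => Q (t + u)) σ :=
  ⟨fun ⟨_, _, h, hQ⟩ => by
    cases h with
    | seq h₁ h₂ => exact ⟨_, _, h₁, _, _, h₂, hQ⟩,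
  fun ⟨_, _, h₁, _, _, h₂, hQ⟩ => ⟨_, _, .seq h₁ h₂, hQ⟩⟩

theorem ensures_ite :
    Ensures I (.ifThenElse b p q) Q σ ↔
      (b.holds σ → Ensures I p (fun t => Q (1 + t)) σ) ∧
      (¬ b.holds σ → Ensures I q (fun t => Q (1 + t)) σ) := by
  constructor
  · rintro ⟨_, _, h, hQ⟩
    cases h with
    | ifTrue hb h => exact ⟨fun _ => ⟨_, _, h, hQ⟩, fun hn => absurd hb hn⟩
    | ifFalse hb h => exact ⟨fun hn => absurd hn hb, fun _ => ⟨_, _, h, hQ⟩⟩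
  · rintro ⟨h₁, h₂⟩
    by_cases hb : b.holds σ
    · obtain ⟨_, _, h, hQ⟩ := h₁ hb
      exact ⟨_, _, .ifTrue hb h, hQ⟩
    · obtain ⟨_, _, h, hQ⟩ := h₂ hb
      exact ⟨_, _, .ifFalse hb h, hQ⟩

/-- A loop whose iterations are paid for by a potential `k`. -/
theorem ensures_loop (Inv : ℕ → State → Prop)
    (hstep : ∀ k σ, Inv k σ → b.holds σ →
      Ensures I p (fun t τ => ∃ k', Inv k' τ ∧ t + 1 + k' ≤ k) σ) {k : ℕ} (h : Inv k σ) :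
    Ensures I (.loop b p)
      (fun t τ => ∃ k', Inv k' τ ∧ ¬ b.holds τ ∧ t + k' ≤ k + 1) σ := by
  induction k using Nat.strong_induction_on generalizing σ with
  | _ k ih =>
    by_cases hb : b.holds σ
    · obtain ⟨t, τ, hexec, k', hInv, hk⟩ := hstep k σ h hb
      obtain ⟨u, ρ, hexec', k'', hInv', hb', hk'⟩ := ih k' (by omega) hInv
      exact ⟨_, _, .loopTrue hb hexec hexec', k'', hInv', hb', by omega⟩
    · exact ⟨1, σ, .loopFalse hb, k, h, hb, by omega⟩

variable {r d x a i c j : ℕ}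

@[simp] theorem State.setReg_reg : (σ.setReg d x).reg r = if r = d then x else σ.reg r :=
  Function.update_apply _ _ _ _

@[simp] theorem State.setReg_arr : (σ.setReg d x).arr = σ.arr := rfl

@[simp] theorem State.setArr_reg : (σ.setArr a i x).reg = σ.reg := rfl

@[simp] theorem State.setArr_arr :
    (σ.setArr a i x).arr c j = if c = a ∧ j = i then x else σ.arr c j := by
  by_cases hc : c = a <;> by_cases hj : j = i <;> simp [State.setArr, hc, hj]

end Calculus

section Extension

variable {V : Type*}

/-- The distance from each vertex to its next ancestor with a nonzero value exists. -/
theorem exists_distance (T : WGraph.RootedTree V) {A : V → ℕ} (hroot : A T.root ≠ 0) :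
    ∃ d : V → ℕ, (∀ v, A v ≠ 0 → d v = 0) ∧ ∀ v, A v = 0 → d v = d (T.parent v) + 1 := by
  classical
  have hex : ∀ v, ∃ k, A (T.parent^[k] v) ≠ 0 := fun v => by
    obtain ⟨k, hk⟩ := T.reaches_root v
    exact ⟨k, hk ▸ hroot⟩
  refine ⟨fun v => Nat.find (hex v), fun v hv => (Nat.find_eq_zero _).2 hv, fun v hv => ?_⟩
  exact Nat.find_comp_succ (hex v) (hex (T.parent v)) (by simpa using hv)

/-- The copies of the values at the next ancestors with nonzero values exist. -/
theorem exists_extension (T : WGraph.RootedTree V) {A : V → ℕ} (hroot : A T.root ≠ 0) :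
    ∃ F : V → ℕ, (∀ v, F v ≠ 0) ∧ (∀ v, A v ≠ 0 → F v = A v) ∧
      ∀ v, A v = 0 → F v = F (T.parent v) := by
  obtain ⟨d, hd₀, hd₁⟩ := exists_distance T hroot
  refine ⟨fun v => A (T.parent^[d v] v), fun v => ?_, fun v hv => by simp [hd₀ v hv],
    fun v hv => by simp [hd₁ v hv]⟩
  show A (T.parent^[d v] v) ≠ 0
  induction hn : d v generalizing v with
  | zero =>
    intro h
    have := hd₁ v h
    omega
  | succ n ih =>
    have hv : A v = 0 := by
      by_contra hv
      have := hd₀ v hv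
      omega
    have hd := hd₁ v hv
    exact ih (T.parent v) (by omega)

end Extension

/-! ### Copying values down the tree in linear time -/

section Fill

variable {V : Type*} [Fintype V] {e : V ≃ Fin (Fintype.card V)} {T : WGraph.RootedTree V}
  {I : Input}

/-- The registers `0` and `1` hold these numbers, and register `2` holds the size of the input. -/
def State.Ready (I : Input) (σ : State) : Prop := σ.reg 0 = 0 ∧ σ.reg 1 = 1 ∧ σ.reg 2 = I.n

/-- For each vertex, walk up the tree to the next ancestor whose cell of array `a` is not zero, and
copy the content of that cell to the cells of the vertices on the way. -/
def fill (a : ℕ) : Prog :=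
  .seq (.instr (.const 3 0)) <| .loop (.lt 3 2) <|
    .seq (.instr (.move 4 3)) <| .seq (.instr (.load 5 a 4)) <|
    .seq (.loop (.eq 5 0) (.seq (.instr (.readPar 4 4)) (.instr (.load 5 a 4)))) <|
    .seq (.instr (.move 4 3)) <| .seq (.instr (.load 6 a 4)) <|
    .seq (.loop (.eq 6 0) (.seq (.instr (.store a 4 5)) <|
      .seq (.instr (.readPar 4 4)) (.instr (.load 6 a 4)))) <|
    .instr (.inc 3)

/-- The number of zeros of `A`. -/
def zeros (A : V → ℕ) : ℕ := (Finset.univ.filter fun v => A v = 0).card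

theorem zeros_le (A : V → ℕ) : zeros A ≤ Fintype.card V := Finset.card_le_univ _

theorem zeros_lt {A A' : V → ℕ} {x : V} (h : ∀ u, A' u = 0 → A u = 0) (hx : A x = 0)
    (hx' : A' x ≠ 0) : zeros A' < zeros A := by
  refine Finset.card_lt_card ⟨fun u hu => ?_, fun hc => ?_⟩
  · simpa using h u (by simpa using hu)
  · exact hx' (by simpa using hc (show x ∈ Finset.univ.filter fun v => A v = 0 by simpa using hx))

theorem ensures_fill (hpar : ∀ v, I.par (e v) = e (T.parent v)) (hn : I.n = Fintype.card V)
    {a : ℕ} {σ : State} (hσ : σ.Ready I) {F : V → ℕ} (hF : ∀ v, F v ≠ 0)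
    (hroot : σ.arr a (e T.root) ≠ 0) (hF₀ : ∀ v, σ.arr a (e v) ≠ 0 → F v = σ.arr a (e v))
    (hF₁ : ∀ v, σ.arr a (e v) = 0 → F v = F (T.parent v)) :
    Ensures I (fill a) (fun t τ => t ≤ 15 * Fintype.card V + 2 ∧ τ.Ready I ∧
      (∀ v, τ.arr a (e v) = F v) ∧ ∀ a' ≠ a, τ.arr a' = σ.arr a') σ := by
  have henc : ∀ {u v : V}, (e u : ℕ) = e v ↔ u = v := by simp [Fin.val_inj]
  -- The potential charges 8 steps to each vertex and 7 to each zero cell: 3 for a step of the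
  -- searching walk and 4 for a step of the writing walk.
  let Inv : ℕ → State → Prop := fun k τ => τ.Ready I ∧ τ.reg 3 ≤ I.n ∧
    (∀ v, (e v : ℕ) < τ.reg 3 → τ.arr a (e v) ≠ 0) ∧
    (∀ v, τ.arr a (e v) = F v ∨ τ.arr a (e v) = 0 ∧ σ.arr a (e v) = 0) ∧
    (∀ a' ≠ a, τ.arr a' = σ.arr a') ∧
    k = 8 * (I.n - τ.reg 3) + 7 * zeros fun v => τ.arr a (e v)
  have hstart : Inv (8 * I.n + 7 * zeros fun v => σ.arr a (e v))
      ((Instr.const 3 0).run I σ) := by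
    refine ⟨by simpa [State.Ready, Instr.run] using hσ, by simp [Instr.run],
      by simp [Instr.run], fun v => ?_, by simp [Instr.run], by simp [Instr.run]⟩
    by_cases hv : σ.arr a (e v) = 0
    · simp [Instr.run, hv]
    · simp [Instr.run, hF₀ v hv]
  rw [fill, ensures_seq, ensures_instr]
  refine (ensures_loop Inv ?_ hstart).mono ?_
  · rintro k τ ⟨hR, hle, hdone, hval, harr, rfl⟩ hb
    have hlt : τ.reg 3 < I.n := by
      have h : τ.reg 3 < τ.reg 2 := hb
      rwa [hR.2.2] at h
    obtain ⟨v, hv⟩ : ∃ v, (e v : ℕ) = τ.reg 3 :=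
      ⟨e.symm ⟨τ.reg 3, hn ▸ hlt⟩, by simp⟩
    set A : V → ℕ := fun v => τ.arr a (e v) with hA
    have hrootA : A T.root ≠ 0 := by
      rcases hval T.root with h | h
      · exact fun h' => hF _ (h.symm.trans h')
      · exact absurd h.2 hroot
    have hFA : ∀ u, A u ≠ 0 → F u = A u := fun u hu =>
      ((hval u).resolve_right fun h => hu h.1).symm
    have hFA' : ∀ u, A u = 0 → F u = F (T.parent u) := fun u hu =>
      hF₁ u ((hval u).resolve_left fun h => hF u (h ▸ hu)).2
    obtain ⟨d, hd₀, hd₁⟩ := exists_distance T hrootA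
    have hne : ∀ u, A u = 0 → u ≠ T.root := by
      rintro u hu rfl
      exact hrootA hu
    let Inv₁ : ℕ → State → Prop := fun k ρ => ρ.Ready I ∧ ρ.reg 3 = τ.reg 3 ∧ ρ.arr = τ.arr ∧
      ∃ x, ρ.reg 4 = e x ∧ ρ.reg 5 = A x ∧ F x = F v ∧ k = 3 * d x
    -- Newly written cells belong to vertices that the walk has left below it (`x ∉ T.subtree u`),
    -- so it can only stop at a cell that was nonzero before. The bound on `zeros` says that each
    -- step filled a cell.
    let Inv₂ : ℕ → State → Prop := fun k ρ => ρ.Ready I ∧ ρ.reg 3 = τ.reg 3 ∧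
      ρ.reg 5 = F v ∧ (∀ a' ≠ a, ρ.arr a' = τ.arr a') ∧
      ∃ x, ρ.reg 4 = e x ∧ ρ.reg 6 = ρ.arr a (e x) ∧ F x = F v ∧
      (∀ u, ρ.arr a (e u) = A u ∨
        A u = 0 ∧ ρ.arr a (e u) = F v ∧ F u = F v ∧ x ∉ T.subtree u) ∧
      (x = v ∨ ρ.arr a (e v) ≠ 0) ∧ (zeros fun u => ρ.arr a (e u)) + d v ≤ zeros A + d x ∧
      k = 4 * d x
    simp only [ensures_seq, ensures_instr]
    have hs₁ : Inv₁ (3 * d v) ((Instr.load 5 a 4).run I ((Instr.move 4 3).run I τ)) := by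
      refine ⟨by simpa [State.Ready, Instr.run] using hR, by simp [Instr.run],
        by simp [Instr.run], v, by simp [Instr.run, hv], by simp [Instr.run, hv, hA], rfl, rfl⟩
    refine (ensures_loop Inv₁ ?_ hs₁).mono ?_
    · rintro k ρ ⟨hR', h3, harr', x, h4, h5, hFx, rfl⟩ hb
      have hAx : A x = 0 := by
        have h : ρ.reg 5 = ρ.reg 0 := hb
        rw [← h5, h, hR'.1]
      simp only [ensures_seq, ensures_instr]
      refine ⟨3 * d (T.parent x), ⟨by simpa [State.Ready, Instr.run] using hR',
        by simp [Instr.run, h3], by simp [Instr.run, harr'], T.parent x,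
        by simp [Instr.run, h4, hpar], by simp [Instr.run, h4, hpar, harr', hA],
        (hFA' x hAx) ▸ hFx, rfl⟩, ?_⟩
      have := hd₁ x hAx
      omega
    · rintro t₁ ρ₁ ⟨k₁, ⟨hR₁, h3, harr₁, y, h4, h5, hFy, -⟩, hb₁, ht₁⟩
      have hAy : A y ≠ 0 := by
        intro h
        exact hb₁ (show ρ₁.reg 5 = ρ₁.reg 0 by rw [h5, h, hR₁.1])
      have hs₂ : Inv₂ (4 * d v) ((Instr.load 6 a 4).run I ((Instr.move 4 3).run I ρ₁)) := by
        refine ⟨by simpa [State.Ready, Instr.run] using hR₁, by simp [Instr.run, h3],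
          by simp [Instr.run, h5, ← hFA y hAy, hFy], by simp [Instr.run, harr₁], v,
          by simp [Instr.run, h3, hv], by simp [Instr.run, h3, hv], rfl, fun u => .inl ?_,
          .inl rfl, le_of_eq ?_, rfl⟩
        · simp [Instr.run, harr₁, hA]
        · simp [Instr.run, harr₁, hA]
      simp only [ensures_seq, ensures_instr]
      refine (ensures_loop Inv₂ ?_ hs₂).mono ?_
      · rintro k ρ ⟨hR', h3, h5, harr', x, h4, h6, hFx, hset, hv', hz, rfl⟩ hb
        have hρx : ρ.arr a (e x) = 0 := by
          have h : ρ.reg 6 = ρ.reg 0 := hb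
          rw [← h6, h, hR'.1]
        have hAx : A x = 0 := by
          rcases hset x with h | h
          · rw [← h, hρx]
          · exact h.1
        have hdx := hd₁ x hAx
        have hz' : (zeros fun u => if (e u : ℕ) = e x then F v else ρ.arr a (e u)) <
            zeros fun u => ρ.arr a (e u) := by
          refine zeros_lt (x := x) (fun u hu => ?_) hρx (by simpa using hF v)
          by_cases hux : u = x
          · rw [hux, hρx]
          · simpa [henc, hux] using hu
        simp only [ensures_seq, ensures_instr]
        refine ⟨4 * d (T.parent x), ⟨by simpa [State.Ready, Instr.run] using hR',
          by simp [Instr.run, h3], by simp [Instr.run, h5], fun a' ha' => ?_, T.parent x,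
          by simp [Instr.run, h4, hpar], by simp [Instr.run, h4, hpar],
          (hFA' x hAx) ▸ hFx, fun u => ?_, .inr ?_, ?_, rfl⟩, ?_⟩
        · funext j
          simp [Instr.run, ha', harr' a' ha']
        · by_cases hux : u = x
          · subst hux
            exact .inr ⟨hAx, by simp [Instr.run, h4, h5], hFx, T.parent_notMem_subtree (hne u hAx)⟩
          · have : ((e u : ℕ) = e x) = False := by simp [henc, hux]
            simp only [Instr.run, h4, State.setReg_arr, State.setArr_arr, this, and_false,
              if_false]
            exact (hset u).imp_right fun h =>
              ⟨h.1, h.2.1, h.2.2.1, fun hc => h.2.2.2 (T.mem_subtree_of_parent_mem hc)⟩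
        · simp only [Instr.run, h4, h5, State.setReg_arr, State.setArr_arr, eq_self, true_and, henc]
          split_ifs with hvx
          · exact hF v
          · exact hv'.resolve_left fun h => hvx ⟨rfl, henc.2 h.symm⟩
        · simp only [Instr.run, h4, h5, State.setReg_arr, State.setArr_arr, eq_self, true_and]
          omega
        · omega
      · rintro t₂ ρ₂ ⟨k₂, ⟨hR₂, h3', h5', harr₂, x, h4', h6, hFx, hset, hv', hz, -⟩, hb₂, ht₂⟩
        have hρx : ρ₂.arr a (e x) ≠ 0 := by
          intro h
          exact hb₂ (show ρ₂.reg 6 = ρ₂.reg 0 by rw [h6, h, hR₂.1])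
        have hdx : d x = 0 := by
          refine hd₀ x ?_
          rcases hset x with h | h
          · rwa [← h]
          · exact absurd (T.mem_subtree_self x) h.2.2.2
        have hv'' : ρ₂.arr a (e v) ≠ 0 := by
          rcases hv' with rfl | h
          · exact hρx
          · exact h
        rw [ensures_instr]
        refine ⟨_, ⟨by simpa [State.Ready, Instr.run] using hR₂,
          by simp only [Instr.run, State.setReg_reg, if_true]; omega, fun u hu => ?_,
          fun u => ?_, fun a' ha' => ?_, rfl⟩, ?_⟩
        · simp only [Instr.run, State.setReg_arr, State.setReg_reg, if_true, h3'] at hu ⊢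
          rcases hset u with h | h
          · rcases Nat.lt_succ_iff_lt_or_eq.1 hu with h' | h'
            · rw [h]
              exact hdone u h'
            · rw [← hv, henc] at h'
              rwa [h']
          · rw [h.2.1]
            exact hF v
        · simp only [Instr.run, State.setReg_arr]
          rcases hset u with h | h
          · rw [h]
            exact hval u
          · exact .inl (h.2.1.trans h.2.2.1.symm)
        · simp only [Instr.run, State.setReg_arr]
          rw [harr₂ a' ha', harr a' ha']
        · simp only [Instr.run, State.setReg_arr, State.setReg_reg, if_true, h3']
          omega
  · rintro t τ ⟨k', ⟨hR, hle, hdone, hval, harr, rfl⟩, hb, ht⟩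
    have hz := zeros_le fun v => σ.arr a (e v)
    refine ⟨by omega, hR, fun v => ?_, harr⟩
    have hlt : (e v : ℕ) < τ.reg 3 := by
      have h : ¬ τ.reg 3 < τ.reg 2 := hb
      have := (e v).2
      rw [hR.2.2] at h
      omega
    exact (hval v).resolve_right fun h => hdone v hlt h.1

end Fill

end RAM

namespace RAM

section Codes

variable {V : Type*} [Fintype V] {e : V ≃ Fin (Fintype.card V)}

/-- The number that represents the index of an opposite chain. -/
def code (e : V ≃ Fin (Fintype.card V)) : Option V → ℕ
  | none => 1
  | some r => e r + 2

/-- The value 0 marks cells that are not yet written. -/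
theorem code_ne_zero (c : Option V) : code e c ≠ 0 := by cases c <;> simp [code]

end Codes

/-! ### The programs that code the chain and mark the tops of clusters -/

section Labelling

variable {V : Type*} [Fintype V] [DecidableEq V] {e : V ≃ Fin (Fintype.card V)} {G : WGraph V}
  {T : WGraph.RootedTree V} {S : Finset V} {I : Input}

/-- Test whether the vertex in register `x` is in the set whose code is in register `c`. -/
def member (c x d : ℕ) : Prog :=
  .ifThenElse (.eq c 1) (.instr (.readMem d x))
    (.seq (.instr (.move 12 c)) <| .seq (.instr (.dec 12)) <| .seq (.instr (.dec 12)) <|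
      .instr (.readOpp d 12 x))

/-- Two decrements turn the code of `some r` into the matrix row of `r`, which describes X because
the opposite SC is unique. -/
theorem ensures_member (hI : I.Encodes e G T S) {j x d : ℕ} {σ : State} {Q : ℕ → State → Prop}
    {v : V} {c : Option V} {X : Finset V} (h : G.OppositeChain T S c X) (hσ : σ.Ready I)
    (hj : σ.reg j = code e c) (hx : σ.reg x = e v) (hx' : x ≠ 12)
    (hQ : ∀ t τ, t ≤ 5 → τ.arr = σ.arr → (∀ r, r ≠ d → r ≠ 12 → τ.reg r = σ.reg r) →
      τ.reg d = (if v ∈ X then 1 else 0) → Q t τ) :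
    Ensures I (member j x d) Q σ := by
  obtain ⟨-, -, hmem, hopp⟩ := hI
  rw [member, ensures_ite]
  simp only [ensures_seq, ensures_instr]
  have hcode : Test.holds σ (.eq j 1) ↔ c = none := by
    simp only [Test.holds, hj, hσ.2.1]
    cases c <;> simp [code]
  constructor
  · intro hb
    obtain rfl := hcode.1 hb
    cases h
    refine hQ _ _ (by norm_num) rfl (fun r hr _ => by simp [Instr.run, hr]) ?_
    simp [Instr.run, hx, hmem]
  · intro hb
    cases c with
    | none => exact absurd (hcode.2 rfl) hb
    | some r =>
      obtain ⟨X', hX', hrow⟩ := hopp r h.edge.1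
      have hXX : X' = X := by
        cases h with
        | step _ _ _ hX => exact hX'.unique hX
      refine hQ _ _ (by norm_num) rfl (fun r hr hr' => by simp [Instr.run, hr, hr']) ?_
      simp [Instr.run, hx, hx', hj, code, hrow, hXX]

/-- Set up the registers `0`, `1`, `2`, and find a vertex of `S`. -/
def findSource : Prog :=
  .seq (.instr (.const 1 1)) <| .seq (.instr (.size 2)) <| .seq (.instr (.readMem 5 3)) <|
    .loop (.eq 5 0) (.seq (.instr (.inc 3)) (.instr (.readMem 5 3)))

theorem ensures_findSource (hI : I.Encodes e G T S) (hS : S.Nonempty) :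
    Ensures I findSource (fun t τ => t ≤ 3 * Fintype.card V + 4 ∧ τ.Ready I ∧ τ.reg 9 = 0 ∧
      τ.arr = State.init.arr ∧ ∃ s ∈ S, τ.reg 3 = e s) State.init := by
  obtain ⟨hn, -, hmem, -⟩ := hI
  obtain ⟨s, hs⟩ := hS
  have hes : I.mem (e s) = 1 := by simp [hmem, hs]
  let Inv : ℕ → State → Prop := fun k τ => τ.Ready I ∧ τ.reg 9 = 0 ∧ τ.arr = State.init.arr ∧
    τ.reg 3 ≤ e s ∧ τ.reg 5 = I.mem (τ.reg 3) ∧ k = 3 * (e s - τ.reg 3)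
  simp only [findSource, ensures_seq, ensures_instr]
  refine (ensures_loop (k := 3 * e s) Inv ?_ ?_).mono ?_
  · rintro k τ ⟨hR, h9, harr, h3, h5, rfl⟩ hb
    have hne : τ.reg 3 ≠ e s := by
      intro hc
      have h : τ.reg 5 = τ.reg 0 := hb
      rw [h5, hR.1, hc, hes] at h
      exact one_ne_zero h
    simp only [ensures_seq, ensures_instr]
    refine ⟨_, ⟨by simpa [State.Ready, Instr.run] using hR, by simp [Instr.run, h9],
      by simp [Instr.run, harr], ?_, by simp [Instr.run], rfl⟩, ?_⟩
    · simp [Instr.run]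
      omega
    · simp [Instr.run]
      omega
  · refine ⟨by simp [State.Ready, Instr.run, State.init], by simp [Instr.run, State.init],
      by simp [Instr.run], by simp [Instr.run, State.init], by simp [Instr.run],
      by simp [Instr.run, State.init]⟩
  · rintro t τ ⟨k, ⟨hR, h9, harr, h3, h5, rfl⟩, hb, ht⟩
    have hlt := (e s).2
    refine ⟨by omega, hR, h9, harr, e.symm ⟨τ.reg 3, by omega⟩, ?_, by simp⟩
    by_contra hc
    have h := hmem (e.symm ⟨τ.reg 3, by omega⟩)
    rw [if_neg hc] at h
    simp only [Equiv.apply_symm_apply] at h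
    exact hb (show τ.reg 5 = τ.reg 0 by rw [h5, h, hR.1])

/-- Walk up from the vertex in register `3` to the root, and write to array `1`, for each vertex on
the way, the code of the set of the opposite chain that contains it. -/
def walk : Prog :=
  .seq (.instr (.const 6 1)) <| .loop (.eq 9 0) <|
    .seq (member 6 3 5) <|
    .seq (.ifThenElse (.eq 5 0)
      (.seq (.instr (.move 6 4)) <| .seq (.instr (.inc 6)) (.instr (.inc 6))) .skip) <|
    .seq (.instr (.store 1 3 6)) <| .seq (.instr (.move 4 3)) <|
    .seq (.instr (.readPar 3 3)) (.instr (.load 9 1 3))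

theorem ensures_walk (hI : I.Encodes e G T S) (hT : G.IsCommunityCutTree T) (hS : G.IsSC S)
    {σ : State} (hσ : σ.Ready I) (h9 : σ.reg 9 = 0) (harr : σ.arr = State.init.arr) {s : V}
    (hs : s ∈ S) (h3 : σ.reg 3 = e s) :
    Ensures I walk (fun t τ => t ≤ 14 * Fintype.card V + 2 ∧ τ.Ready I ∧
      τ.arr 0 = State.init.arr 0 ∧ (∀ u, s ∈ T.subtree u → τ.arr 1 (e u) ≠ 0) ∧
      ∀ u, τ.arr 1 (e u) ≠ 0 → s ∈ T.subtree u ∧ ∃ c X, G.OppositeChain T S c X ∧ u ∈ X ∧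
        τ.arr 1 (e u) = code e c) σ := by
  have henc : ∀ {u v : V}, (e u : ℕ) = e v ↔ u = v := by simp [Fin.val_inj]
  have hpar : ∀ v, I.par (e v) = e (T.parent v) := hI.2.1
  -- Register 4 remembers the previous vertex, in case `x` has just left the current set. The walk
  -- stops at a coded cell; as coded vertices other than the root have been passed, that can only be
  -- the root, which is its own parent. An iteration takes at most 14 steps and fills a cell.
  let Inv : ℕ → State → Prop := fun k τ => τ.Ready I ∧ τ.arr 0 = State.init.arr 0 ∧
    ∃ x c X, τ.reg 3 = e x ∧ τ.reg 6 = code e c ∧ G.OppositeChain T S c X ∧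
      τ.reg 9 = τ.arr 1 (e x) ∧
      (x ∈ X ∨ ∃ p, τ.reg 4 = e p ∧ p ∈ X ∧ T.parent p = x) ∧
      (∀ u, τ.arr 1 (e u) ≠ 0 → (u = T.root ∨ x ∉ T.subtree u) ∧
        s ∈ T.subtree u ∧ ∃ c X, G.OppositeChain T S c X ∧ u ∈ X ∧ τ.arr 1 (e u) = code e c) ∧
      s ∈ T.subtree x ∧ (∀ u, s ∈ T.subtree u → τ.arr 1 (e u) ≠ 0 ∨ x ∈ T.subtree u) ∧
      k = 14 * zeros fun u => τ.arr 1 (e u)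
  rw [walk, ensures_seq, ensures_instr]
  refine (ensures_loop (k := 14 * zeros fun u => σ.arr 1 (e u)) Inv ?_ ?_).mono ?_
  · rintro k τ ⟨hR, h0, x, c, X, h3, h6, hX, h9, hx, hmark, hsx, hpath, rfl⟩ hb
    have hτx : τ.arr 1 (e x) = 0 := by
      have h : τ.reg 9 = τ.reg 0 := hb
      rw [← h9, h, hR.1]
    -- the common part of the two branches
    have key : ∀ (t : ℕ) (ρ : State), t ≤ 9 → ρ.arr = τ.arr → ρ.Ready I → ρ.reg 3 = e x →
        ∀ c X, ρ.reg 6 = code e c → G.OppositeChain T S c X → x ∈ X →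
        ∃ k', Inv k' ((Instr.load 9 1 3).run I ((Instr.readPar 3 3).run I
          ((Instr.move 4 3).run I ((Instr.store 1 3 6).run I ρ)))) ∧
          t + 5 + k' ≤ 14 * zeros fun u => τ.arr 1 (e u) := by
      intro t ρ ht hρ hR' h3' c X h6' hX hxX
      have hz : (zeros fun u => if (e u : ℕ) = e x then code e c else τ.arr 1 (e u)) <
          zeros fun u => τ.arr 1 (e u) := by
        refine zeros_lt (x := x) (fun u hu => ?_) hτx (by simpa using code_ne_zero c)
        by_cases hux : u = x
        · rw [hux, hτx]
        · simpa [henc, hux] using hu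
      refine ⟨_, ⟨by simpa [State.Ready, Instr.run] using hR', ?_, T.parent x, c, X,
        by simp [Instr.run, h3', hpar], by simp [Instr.run, h6'], hX,
        by simp [Instr.run, h3', hpar], .inr ⟨x, by simp [Instr.run, h3'], hxX, rfl⟩, ?_,
        T.mem_subtree_trans hsx (T.mem_subtree_parent x), ?_, rfl⟩, ?_⟩
      · funext j
        simp [Instr.run, hρ, h0]
      · intro u hu
        by_cases hux : u = x
        · subst hux
          refine ⟨?_, hsx, c, X, hX, hxX, by simp [Instr.run, h3', h6']⟩
          exact or_iff_not_imp_left.2 fun hur => T.parent_notMem_subtree hur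
        · simp only [Instr.run, State.setReg_arr, State.setArr_arr, h3', h6', henc, hux,
            and_false, if_false, hρ, State.setReg_reg] at hu ⊢
          exact ⟨(hmark u hu).1.imp_right fun h hc => h (T.mem_subtree_of_parent_mem hc),
            (hmark u hu).2⟩
      · intro u hu
        by_cases hux : u = x
        · exact .inl (by simpa [Instr.run, h3', h6', hux] using code_ne_zero c)
        · simp only [Instr.run, State.setReg_arr, State.setArr_arr, h3', h6', henc, hux,
            and_false, if_false, hρ, State.setReg_reg]
          exact (hpath u hu).imp_right fun h => T.parent_mem_subtree h (Ne.symm hux)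
      · simp only [Instr.run, State.setReg_arr, State.setArr_arr, h3', h6', true_and, hρ,
          State.setReg_reg]
        omega
    rw [ensures_seq]
    refine ensures_member hI hX hR h6 h3 (by norm_num) fun t ρ ht hρ hreg h5 => ?_
    have hRρ : ρ.Ready I := by simpa [State.Ready, hreg] using hR
    rw [ensures_seq, ensures_ite]
    simp only [ensures_seq, ensures_instr, ensures_skip]
    constructor
    · intro hb'
      have hxX : x ∉ X := by
        intro hxX
        have h : ρ.reg 5 = ρ.reg 0 := hb'
        simp [h5, hxX, hRρ.1] at h
      obtain ⟨p, h4, hp, hpx⟩ := hx.resolve_left hxX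
      obtain ⟨r, hr⟩ := hT.exists_isRootOf (hX.isSC hS)
      -- The walk has left X, so the previous vertex is the root of X and indexes the next set.
      obtain rfl : p = r := by
        by_contra hne
        exact hxX (hpx ▸ hr.parent_mem p hp hne)
      have hroot : T.root ∉ X := by
        intro hc
        obtain rfl := hr.eq_of_root_mem hc
        rw [T.parent_root] at hpx
        exact hxX (hpx ▸ hp)
      obtain ⟨X', hX', -⟩ := hI.2.2.2 p (by rintro rfl; exact hroot hp)
      obtain ⟨k', hk', hle⟩ := key (t + 4) ((Instr.inc 6).run I ((Instr.inc 6).run I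
        ((Instr.move 6 4).run I ρ))) (by omega) (by simp [Instr.run, hρ])
        (by simpa [State.Ready, Instr.run] using hRρ) (by simp [Instr.run, hreg, h3]) (some p) X'
        (by simp [Instr.run, hreg, h4, code]) (hX.step hr hroot hX') (hpx ▸ hX'.source_mem)
      exact ⟨k', hk', by omega⟩
    · intro hb'
      have hxX : x ∈ X := by
        by_contra hxX
        exact hb' (show ρ.reg 5 = ρ.reg 0 by rw [h5, if_neg hxX, hRρ.1])
      obtain ⟨k', hk', hle⟩ := key (t + 1) ρ (by omega) hρ hRρ (by simp [hreg, h3]) c X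
        (by simp [hreg, h6]) hX hxX
      exact ⟨k', hk', by omega⟩
  · refine ⟨by simpa [State.Ready, Instr.run] using hσ, by simp [Instr.run, harr], s, none, S,
      by simp [Instr.run, h3], by simp [Instr.run, code], .base,
      by simp [Instr.run, h9, harr, State.init], .inl hs, ?_, T.mem_subtree_self s,
      fun u hu => .inr hu, rfl⟩
    simp [Instr.run, harr, State.init]
  · rintro t τ ⟨k, ⟨hR, h0, x, c, X, h3, h6, hX, h9, hx, hmark, hsx, hpath, rfl⟩, hb, ht⟩
    have hz := zeros_le fun u => σ.arr 1 (e u)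
    have hτx : τ.arr 1 (e x) ≠ 0 := by
      intro h
      exact hb (show τ.reg 9 = τ.reg 0 by rw [h9, h, hR.1])
    obtain rfl : x = T.root :=
      (hmark x hτx).1.resolve_right fun h => h (T.mem_subtree_self x)
    refine ⟨by omega, hR, h0, fun u hu => ?_, fun u hu => (hmark u hu).2⟩
    rcases hpath u hu with h | h
    · exact h
    · rwa [T.eq_root_of_root_mem_subtree h]

/-- Write `v + 1` to cell `v` of array `0` for each vertex `v` that is the root, or is separated
from its parent by the codes in array `1` or by the set whose code `v` has. -/
def markTops : Prog :=
  let mark := .seq (.instr (.move 9 8)) <| .seq (.instr (.inc 9)) (.instr (.store 0 8 9))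
  .seq (.instr (.const 8 0)) <| .loop (.lt 8 2) <|
    .seq (.instr (.load 6 1 8)) <| .seq (.instr (.readPar 3 8)) <| .seq (.instr (.load 7 1 3)) <|
    .seq (member 6 8 5) <| .seq (member 6 3 11) <|
    .seq (.ifThenElse (.eq 3 8) mark <| .ifThenElse (.eq 6 7)
      (.ifThenElse (.eq 5 11) .skip mark) mark) <|
    .instr (.inc 8)

theorem ensures_markTops (hI : I.Encodes e G T S) {σ : State} (hσ : σ.Ready I)
    (h0 : σ.arr 0 = State.init.arr 0) {top : V → Prop} [DecidablePred top]
    (htop : ∀ v, ∃ c X, G.OppositeChain T S c X ∧ σ.arr 1 (e v) = code e c ∧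
      (top v ↔ T.parent v = v ∨ σ.arr 1 (e v) ≠ σ.arr 1 (e (T.parent v)) ∨
        ¬ (v ∈ X ↔ T.parent v ∈ X))) :
    Ensures I markTops (fun t τ => t ≤ 25 * Fintype.card V + 2 ∧ τ.Ready I ∧
      ∀ v, τ.arr 0 (e v) = if top v then (e v : ℕ) + 1 else 0) σ := by
  have henc : ∀ {u v : V}, (e u : ℕ) = e v ↔ u = v := by simp [Fin.val_inj]
  have hpar : ∀ v, I.par (e v) = e (T.parent v) := hI.2.1
  have hn : I.n = Fintype.card V := hI.1
  let Inv : ℕ → State → Prop := fun k τ => τ.Ready I ∧ τ.reg 8 ≤ I.n ∧ τ.arr 1 = σ.arr 1 ∧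
    (∀ v, τ.arr 0 (e v) = if (e v : ℕ) < τ.reg 8 ∧ top v then (e v : ℕ) + 1 else 0) ∧
    k = 25 * (I.n - τ.reg 8)
  rw [markTops, ensures_seq, ensures_instr]
  refine (ensures_loop (k := 25 * I.n) Inv ?_ ?_).mono ?_
  · rintro k τ ⟨hR, hle, h1, hval, rfl⟩ hb
    have hlt : τ.reg 8 < I.n := by
      have h : τ.reg 8 < τ.reg 2 := hb
      rwa [hR.2.2] at h
    obtain ⟨v, hv⟩ : ∃ v, (e v : ℕ) = τ.reg 8 :=
      ⟨e.symm ⟨τ.reg 8, hn ▸ hlt⟩, by simp⟩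
    obtain ⟨c, X, hX, hc, htopv⟩ := htop v
    -- The common end of all branches, whether or not `v` was marked.
    have hfin : ∀ (ρ : State) (t : ℕ), t ≤ 22 → ρ.Ready I → ρ.reg 8 = τ.reg 8 → ρ.arr 1 = τ.arr 1 →
        (∀ u, ρ.arr 0 (e u) = if u = v ∧ top v then (e v : ℕ) + 1 else τ.arr 0 (e u)) →
        ∃ k', Inv k' ((Instr.inc 8).run I ρ) ∧
          t + 1 + 1 + k' ≤ 25 * (I.n - τ.reg 8) := by
      intro ρ t ht hR' h8 h1' h0'
      refine ⟨_, ⟨by simpa [State.Ready, Instr.run] using hR', by simp [Instr.run, h8]; omega,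
        by simp [Instr.run, h1', h1], fun u => ?_, rfl⟩, by simp [Instr.run, h8]; omega⟩
      simp only [Instr.run, State.setReg_arr, State.setReg_reg, if_true, h8, h0', hval, ← hv]
      by_cases huv : u = v
      · subst huv
        simp
      · have : (e u : ℕ) ≠ e v := fun h => huv (henc.1 h)
        have h₂ : (e u : ℕ) < e v + 1 ↔ (e u : ℕ) < e v := by omega
        simp [huv, h₂]
    simp only [ensures_seq, ensures_instr]
    refine ensures_member (x := 8) hI (v := v) hX ?_ ?_ ?_ (by norm_num)
      fun t₁ ρ₁ ht₁ hρ₁ hreg₁ h5 => ?_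
    · simpa [State.Ready, Instr.run] using hR
    · simp [Instr.run, ← hv, h1, hc]
    · simp [Instr.run, hv]
    rw [ensures_seq]
    refine ensures_member (x := 3) hI (v := T.parent v) hX ?_ ?_ ?_ (by norm_num)
      fun t₂ ρ₂ ht₂ hρ₂ hreg₂ h11 => ?_
    · simpa [State.Ready, hreg₁, Instr.run] using hR
    · simp [hreg₁, Instr.run, ← hv, h1, hc]
    · simp [hreg₁, Instr.run, ← hv, hpar]
    have harr₂ : ρ₂.arr = τ.arr := by simp [hρ₂, hρ₁, Instr.run]
    have hR₂ : ρ₂.Ready I := by simpa [State.Ready, hreg₁, hreg₂, Instr.run] using hR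
    have r3 : ρ₂.reg 3 = e (T.parent v) := by simp [hreg₁, hreg₂, Instr.run, ← hv, hpar]
    have r5 : ρ₂.reg 5 = if v ∈ X then 1 else 0 := by simp [hreg₂, h5]
    have r6 : ρ₂.reg 6 = σ.arr 1 (e v) := by simp [hreg₁, hreg₂, Instr.run, ← hv, h1]
    have r7 : ρ₂.reg 7 = σ.arr 1 (e (T.parent v)) := by
      simp [hreg₁, hreg₂, Instr.run, ← hv, h1, hpar]
    have r8 : ρ₂.reg 8 = e v := by simp [hreg₁, hreg₂, Instr.run, ← hv]
    have b₁ : Test.holds ρ₂ (.eq 3 8) ↔ T.parent v = v := by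
      simp only [Test.holds, r3, r8, henc]
    have b₂ : Test.holds ρ₂ (.eq 6 7) ↔ σ.arr 1 (e v) = σ.arr 1 (e (T.parent v)) := by
      simp only [Test.holds, r6, r7]
    have b₃ : Test.holds ρ₂ (.eq 5 11) ↔ (v ∈ X ↔ T.parent v ∈ X) := by
      simp only [Test.holds, r5, h11]
      by_cases v ∈ X <;> by_cases T.parent v ∈ X <;> simp [*]
    have hmark : ∀ t, t ≤ 19 → top v → ∃ k', Inv k' ((Instr.inc 8).run I
        ((Instr.store 0 8 9).run I ((Instr.inc 9).run I ((Instr.move 9 8).run I ρ₂)))) ∧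
          t + (1 + (1 + 1)) + 1 + 1 + k' ≤ 25 * (I.n - τ.reg 8) := by
      intro t ht htv
      refine hfin _ _ (by omega) (by simpa [State.Ready, Instr.run] using hR₂)
        (by simp [Instr.run, r8, hv]) (by funext; simp [Instr.run, harr₂]) fun u => ?_
      simp [Instr.run, r8, harr₂, htv, henc]
    simp only [ensures_ite, ensures_seq, ensures_instr, ensures_skip, b₁, b₂, b₃]
    refine ⟨fun h₁ => ?_, fun h₁ => ⟨fun h₂ => ⟨fun h₃ => ?_, fun h₃ => ?_⟩, fun h₂ => ?_⟩⟩
    · obtain ⟨k', hk', hle⟩ := hmark (1 + (1 + (1 + (t₁ + (t₂ + 1))))) (by omega)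
        (htopv.2 (.inl h₁))
      exact ⟨k', hk', by omega⟩
    · obtain ⟨k', hk', hle⟩ := hfin ρ₂ (1 + (1 + (1 + (t₁ + (t₂ + 3))))) (by omega) hR₂
        (by rw [r8, hv]) (by rw [harr₂]) fun u => by
          rw [if_neg (fun h => ((htopv.1 h.2).resolve_left h₁).elim (fun h => h h₂) fun h => h h₃),
            harr₂]
      exact ⟨k', hk', by omega⟩
    · obtain ⟨k', hk', hle⟩ := hmark (1 + (1 + (1 + (t₁ + (t₂ + 3))))) (by omega)
        (htopv.2 (.inr (.inr h₃)))
      exact ⟨k', hk', by omega⟩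
    · obtain ⟨k', hk', hle⟩ := hmark (1 + (1 + (1 + (t₁ + (t₂ + 2))))) (by omega)
        (htopv.2 (.inr (.inl h₂)))
      exact ⟨k', hk', by omega⟩
  · refine ⟨by simpa [State.Ready, Instr.run] using hσ, by simp [Instr.run], by simp [Instr.run],
      by simp [Instr.run, h0, State.init], by simp [Instr.run]⟩
  · rintro t τ ⟨k, ⟨hR, hle, h1, hval, rfl⟩, hb, ht⟩
    refine ⟨by omega, hR, fun v => ?_⟩
    have hlt : (e v : ℕ) < τ.reg 8 := by
      have h : ¬ τ.reg 8 < τ.reg 2 := hb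
      have := (e v).2
      rw [hR.2.2] at h
      omega
    simp [hval, hlt]

end Labelling

end RAM

namespace RAM

/-! ### Correctness and running time of the labelling -/

section Labelling

variable {V : Type*} [Fintype V] [DecidableEq V] {e : V ≃ Fin (Fintype.card V)} {G : WGraph V}
  {T : WGraph.RootedTree V} {S : Finset V} {I : Input}

open WGraph

/-- The label of a set of the opposite chain is inherited by the vertices of the subtrees that are
attached to it. -/
theorem exists_chain_of_extension (hT : G.IsCommunityCutTree T) {s : V} (hs : s ∈ S)
    {A F : V → ℕ} (hpath : ∀ u, s ∈ T.subtree u → A u ≠ 0)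
    (hA : ∀ u, A u ≠ 0 → s ∈ T.subtree u ∧
      ∃ c X, G.OppositeChain T S c X ∧ u ∈ X ∧ A u = code e c)
    (hF₀ : ∀ v, A v ≠ 0 → F v = A v) (hF₁ : ∀ v, A v = 0 → F v = F (T.parent v)) (v : V) :
    ∃ c X, G.OppositeChain T S c X ∧ F v = code e c ∧ v ∉ T.below c ∧
      (∀ r, T.IsRootOf r X → v ∈ T.subtree r) ∧ (A v ≠ 0 → v ∈ X) := by
  have hmarked : ∀ v, A v ≠ 0 → ∃ c X, G.OppositeChain T S c X ∧ F v = code e c ∧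
      v ∉ T.below c ∧ (∀ r, T.IsRootOf r X → v ∈ T.subtree r) ∧ (A v ≠ 0 → v ∈ X) := by
    intro v hv
    obtain ⟨-, c, X, hX, hvX, hc⟩ := hA v hv
    exact ⟨c, X, hX, (hF₀ v hv).trans hc, Finset.disjoint_left.1 (hX.disjoint_below hT) hvX,
      fun r hr => hr.subset hvX, fun _ => hvX⟩
  refine T.root_induction (p := fun v => ∃ c X, G.OppositeChain T S c X ∧ F v = code e c ∧
    v ∉ T.below c ∧ (∀ r, T.IsRootOf r X → v ∈ T.subtree r) ∧ (A v ≠ 0 → v ∈ X))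
    (hmarked _ (hpath _ (T.mem_subtree_root s)))
    (fun v _ ih => ?_) v
  by_cases hv : A v = 0
  · obtain ⟨c, X, hX, hc, hb, hr, -⟩ := ih
    refine ⟨c, X, hX, (hF₁ v hv).trans hc, fun hvb => ?_,
      fun r hr' => T.mem_subtree_of_parent_mem (hr r hr'), fun h => absurd hv h⟩
    obtain ⟨b, rfl, hvb⟩ := T.mem_below.1 hvb
    -- A vertex without a code cannot enter the cut-off subtree from above: its top is an ancestor
    -- of S and hence has a code.
    refine hb (T.parent_mem_subtree hvb ?_)
    rintro rfl
    exact hpath v (hX.subset_below hs) hv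
  · exact hmarked v hv

/-- The codes and the memberships detect the tree edges between different clusters. -/
theorem part_parent_eq_iff (hT : G.IsCommunityCutTree T) (hS : G.IsSC S) {s : V} (hs : s ∈ S)
    {A F : V → ℕ} (hpath : ∀ u, s ∈ T.subtree u → A u ≠ 0)
    (hA : ∀ u, A u ≠ 0 → s ∈ T.subtree u ∧
      ∃ c X, G.OppositeChain T S c X ∧ u ∈ X ∧ A u = code e c)
    (hF₀ : ∀ v, A v ≠ 0 → F v = A v) (hF₁ : ∀ v, A v = 0 → F v = F (T.parent v)) (v : V) :
    ∃ c X, G.OppositeChain T S c X ∧ F v = code e c ∧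
      ((G.maxClustering hS.nonempty).part v = (G.maxClustering hS.nonempty).part (T.parent v) ↔
        F v = F (T.parent v) ∧ (v ∈ X ↔ T.parent v ∈ X)) := by
  set Ω := G.maxClustering hS.nonempty with hΩ
  have hpart : ∀ {u : V} {C : Finset V}, C ∈ Ω.parts → u ∈ C → Ω.part u = C :=
    fun hC hu => Ω.part_eq_of_mem hC hu
  have hmem : ∀ u, u ∈ Ω.part u := fun u => Ω.mem_part (Finset.mem_univ u)
  obtain ⟨c, X, hX, hc, hb, hr, hvX⟩ :=
    exists_chain_of_extension (e := e) hT hs hpath hA hF₀ hF₁ v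
  have hXΩ : X ∈ Ω.parts := hX.mem_maxClustering hT hS
  obtain ⟨r, hrX⟩ := hT.exists_isRootOf (hX.isSC hS)
  refine ⟨c, X, hX, hc, fun h => ⟨?_, fun hv => ?_, fun hv => ?_⟩, ?_⟩
  -- If `v` has its own code, then so has its parent. Both lie in chain sets, which are clusters, so
  -- a common cluster means a common set and a common index.
  · by_cases hv : A v = 0
    · exact hF₁ v hv
    · have hpv := hpath _ (T.mem_subtree_trans (hA v hv).1 (T.mem_subtree_parent v))
      obtain ⟨-, c', X', hX', hpX', hc'⟩ := hA _ hpv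
      have hXX : X = X' := by
        rw [← hpart hXΩ (hvX hv), h, hpart (hX'.mem_maxClustering hT hS) hpX']
      subst hXX
      rw [hF₀ _ hpv, hc', hc, hX.index_unique hT hS.nonempty hX']
  · rw [← hpart hXΩ hv, h]
    exact hmem _
  · rw [← hpart hXΩ hv, ← h]
    exact hmem _
  · rintro ⟨-, hiff⟩
    by_cases hv : v ∈ X
    · rw [hpart hXΩ hv, hpart hXΩ (hiff.1 hv)]
    -- Both ends lie outside X, so `v` is not the top of its attached subtree, and its parent is in
    -- the same one.
    · obtain ⟨u, hu, -, hpu, hvu, huΩ⟩ := hX.exists_attached_subtree hT hS hrX (hr r hrX) hv hb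
      have hne : v ≠ u := by
        rintro rfl
        exact hv (hiff.2 hpu)
      rw [hpart huΩ hvu, hpart huΩ (T.parent_mem_subtree hvu hne)]

/-- The program that computes the clustering. -/
def clusterProg : Prog :=
  .seq findSource <| .seq walk <| .seq (fill 1) <| .seq markTops (fill 0)

theorem ensures_clusterProg (hI : I.Encodes e G T S) (hT : G.IsCommunityCutTree T)
    (hS : G.IsSC S) :
    Ensures I clusterProg (fun t τ => t ≤ 84 * Fintype.card V ∧
      τ.Outputs e (G.maxClustering hS.nonempty)) State.init := by
  classical
  set Ω := G.maxClustering hS.nonempty with hΩ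
  have hpart : ∀ {u : V} {C : Finset V}, C ∈ Ω.parts → u ∈ C → Ω.part u = C :=
    fun hC hu => Ω.part_eq_of_mem hC hu
  have hmem : ∀ u, u ∈ Ω.part u := fun u => Ω.mem_part (Finset.mem_univ u)
  have hpos : 0 < Fintype.card V := Fintype.card_pos_iff.2 hS.nonempty.to_type
  have hroots : ∀ v, ∃ r, T.IsRootOf r (Ω.part v) := by
    intro v
    refine hT.exists_isRootOf ?_
    rcases (mem_maxClustering hS.nonempty).1 (Ω.part_mem.2 (Finset.mem_univ v)) with h | h
    · rwa [h]
    · exact h.1.1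
  -- Every cluster is connected in the tree, so its root can serve as its label, shifted by one to
  -- be nonzero.
  choose top htop using hroots
  have htop_eq : ∀ {u v : V}, Ω.part u = Ω.part v → top u = top v := fun {u v} h =>
    (htop u).unique (h ▸ (htop v).mem) (h ▸ (htop v).subset)
  simp only [clusterProg, ensures_seq]
  refine (ensures_findSource hI hS.nonempty).mono ?_
  rintro t₁ σ₁ ⟨ht₁, hR₁, h9, harr, s, hs, h3⟩
  rw [ensures_seq]
  refine (ensures_walk hI hT hS hR₁ h9 harr hs h3).mono ?_
  rintro t₂ σ₂ ⟨ht₂, hR₂, h0, hpath, hA⟩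
  obtain ⟨F, hF, hF₀, hF₁⟩ := exists_extension T (A := fun v => σ₂.arr 1 (e v))
    (hpath _ (T.mem_subtree_root s))
  rw [ensures_seq]
  refine (ensures_fill hI.2.1 hI.1 hR₂ hF (hpath _ (T.mem_subtree_root s)) hF₀ hF₁).mono ?_
  rintro t₃ σ₃ ⟨ht₃, hR₃, hcodes, hother⟩
  rw [ensures_seq]
  refine (ensures_markTops (top := fun v => T.parent v = v ∨ Ω.part v ≠ Ω.part (T.parent v))
    hI hR₃ ((hother 0 zero_ne_one).trans h0) fun v => ?_).mono ?_
  · obtain ⟨c, X, hX, hc, hiff⟩ := part_parent_eq_iff hT hS hs hpath hA hF₀ hF₁ v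
    refine ⟨c, X, hX, (hcodes v).trans hc, or_congr_right ?_⟩
    rw [hcodes, hcodes, ← not_and_or]
    exact not_congr hiff
  rintro t₄ σ₄ ⟨ht₄, hR₄, htops⟩
  have hval : ∀ v, σ₄.arr 0 (e v) ≠ 0 → (e (top v) : ℕ) + 1 = σ₄.arr 0 (e v) := by
    intro v hv
    rw [htops] at hv ⊢
    split_ifs at hv ⊢ with h
    · suffices v = top v by rw [← this]
      by_contra hne
      rcases h with h | h
      · obtain rfl : v = T.root := T.eq_root_of_iterate_eq (k := 0) h
        exact hne ((htop _).eq_of_root_mem (hmem _)).symm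
      · refine h (hpart (Ω.part_mem.2 (Finset.mem_univ v)) ?_).symm
        exact (htop v).parent_mem v (hmem v) hne
    · exact absurd rfl hv
  refine (ensures_fill (F := fun v => (e (top v) : ℕ) + 1) hI.2.1 hI.1 hR₄
    (fun _ => Nat.succ_ne_zero _) ?_ hval fun v hv => ?_).mono ?_
  · simp [htops, T.parent_root]
  · rw [htops] at hv
    split_ifs at hv with h
    push Not at h
    rw [htop_eq h.2]
  rintro t₅ σ₅ ⟨ht₅, -, hlabels, -⟩
  -- The five parts take at most 72n + 12 steps, and n ≥ 1.
  refine ⟨by omega, fun u v => ?_⟩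
  rw [hlabels, hlabels, Nat.add_right_cancel_iff, Fin.val_inj, e.apply_eq_iff_eq]
  constructor
  · intro h
    refine ⟨Ω.part u, Ω.part_mem.2 (Finset.mem_univ u), hmem u, ?_⟩
    have : Ω.part u = Ω.part v := by
      rw [← hpart (Ω.part_mem.2 (Finset.mem_univ u)) (htop u).mem, h,
        hpart (Ω.part_mem.2 (Finset.mem_univ v)) (htop v).mem]
    exact this ▸ hmem v
  · rintro ⟨C, hC, hu, hv⟩
    exact htop_eq ((hpart hC hu).trans (hpart hC hv).symm)

end Labelling

end RAM

theorem theorem4 :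
    ∃ (P : RAM.Prog) (K : ℕ), ∀ (V : Type*) [Fintype V] [DecidableEq V] (G : WGraph V)
      (S : Finset V), G.IsSC S →
      ∃ Ω : Finpartition (Finset.univ : Finset V),
        Maximal (G.IsSCClustering S) Ω ∧
        (∀ Ω', Maximal (G.IsSCClustering S) Ω' → Ω' = Ω) ∧
        (∀ Ω', G.IsSCClustering S Ω' → Ω' ≤ Ω) ∧
        (∀ Q, G.IsSC Q → Disjoint Q S → ∃ C ∈ Ω.parts, Q ⊆ C) ∧
        ∀ T : WGraph.RootedTree V, G.IsCommunityCutTree T →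
          (∀ 𝒞 : Set (Finset V), G.Peel T Finset.univ S 𝒞 ↔ 𝒞 = Ω.parts) ∧
          ∀ (e : V ≃ Fin (Fintype.card V)) (I : RAM.Input), I.Encodes e G T S →
            ∃ (t : ℕ) (σ : RAM.State), RAM.Exec I P RAM.State.init t σ ∧
              t ≤ K * Fintype.card V ∧ σ.Outputs e Ω := by
  refine ⟨RAM.clusterProg, 84, fun V _ _ G S hS => ?_⟩
  have hle : ∀ Ω', G.IsSCClustering S Ω' → Ω' ≤ G.maxClustering hS.nonempty :=
    fun Ω' h => h.le_maxClustering hS.nonempty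
  have hΩ := WGraph.isSCClustering_maxClustering (G := G) hS.nonempty
  exact ⟨G.maxClustering hS.nonempty, ⟨hΩ, fun Ω' h _ => hle Ω' h⟩,
    fun Ω' h => (hle Ω' h.1).antisymm (h.2 hΩ (hle Ω' h.1)), hle,
    fun _ => WGraph.exists_subset_maxClustering hS.nonempty,
    fun T hT => ⟨WGraph.peel_iff hT hS, fun e I hI => RAM.ensures_clusterProg hI hT hS⟩⟩
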